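/- Let $\alpha,c\ge 0$ be fixed integers, let $dA(z)=d^2z/\pi$ be the normalised area measure on $\mathbb{C}$, and for $n\ge1$ let $$Q_n(z)=\frac{n+\alpha+c+1}{n}\log(1+|z|^2)-\frac{2c}{n}\log|z| .$$ Let $$Z_n^{\mathbb C}=\int_{\mathbb{C}^n}\prod_{1\le k<j\le n}|z_j-z_k|^2\prod_{j=1}^n e^{-nQ_n(z_j)}\,dA(z_j),$$ $$Z_n^{\mathbb H}=\int_{\mathbb{C}^n}\prod_{1\le k<j\le n}|z_j-z_k|^2|z_j-\overline{z}_k|^2\prod_{j=1}^n|z_j-\overline z_j|^2e^{-2nQ_n(z_j)}\,dA(z_j)$$ be the partition functions of the complex and symplectic induced spherical ensembles. Let $\zeta$ be the Riemann zeta function and let $G$ be the Barnes $G$-function, which satisfies $G(z+1)=\Gamma(z)G(z)$ and $G(1)=1$. Then, as $n\to\infty$, $$\log Z_n^{\mathbb C}=\mathcal A_1n^2+\mathcal A_2\,n\log n+\mathcal A_3n+\mathcal A_4\sqrt n+\mathcal A_5\log n+\mathcal A_6+O(n^{-1}),$$ where $$\mathcal A_1=-\tfrac12,\quad \mathcal A_2=\tfrac12,\quad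 \mathcal A_3=\tfrac{\log(2\pi)}2-1-\alpha-c,\quad \mathcal A_4=0,\quad \mathcal A_5=\tfrac{\alpha^2+c^2}2+\tfrac13,$$ $$\mathcal A_6=\tfrac{\log(2\pi)}2-\tfrac1{12}+2\zeta'(-1)-\tfrac12(\alpha+c)\big(\alpha+c+1-\log(2\pi)\big)-\log\big(G(\alpha+1)G(c+1)\big);$$ and $$\log Z_n^{\mathbb H}=\widehat{\mathcal A}_1n^2+\widehat{\mathcal A}_2\,n\log n+\widehat{\mathcal A}_3n+\widehat{\mathcal A}_4\sqrt n+\widehat{\mathcal A}_5\log n+\widehat{\mathcal A}_6+O(n^{-1}),$$ where $$\widehat{\mathcal A}_1=-1,\quad \widehat{\mathcal A}_2=\tfrac12,\quad \widehat{\mathcal A}_3=\tfrac{\log(4\pi)}2-2-2\alpha-2c,\quad \widehat{\mathcal A}_4=0,\quad \widehat{\mathcal A}_5=\alpha^2+\tfrac\alpha2+c^2+\tfrac c2+\tfrac5{12},$$ $$\widehat{\mathcal A}_6=\log(2\pi)-\tfrac{13}{24}+4\zeta'(-1)-(\alpha+c)\big(\alpha+c+\tfrac32-\log(2\pi)\big)-\log\big(G(\alpha+1)G(\alpha+\tfrac32)G(c+1)G(c+\tfrac32)\big).$$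 The implied constants in the error terms may depend on $\alpha$ and $c$. -/

import Mathlib

open Real MeasureTheory Filter Asymptotics

noncomputable section

namespace InducedSpherical

/-- The normalised area measure `dA(z) = d²z / π` on the complex plane. -/
def areaMeasure : Measure ℂ := NNReal.pi⁻¹ • (volume : Measure ℂ)

instance : SigmaFinite areaMeasure := by
  unfold areaMeasure; infer_instance

/-- Partition function of the determinantal Coulomb gas of `n` particles with potential `V`:
`∫ ∏_{j>k} |z_j - z_k|² ∏_j e^{-n V(z_j)} dA(z_1) ⋯ dA(z_n)`. -/
def partitionC (n : ℕ) (V : ℂ → ℝ) : ℝ :=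
  ∫ z : Fin n → ℂ,
    (∏ j : Fin n, ∏ k ∈ Finset.Iio j, ‖z j - z k‖ ^ 2) *
      ∏ j : Fin n, exp (-((n : ℝ) * V (z j)))
    ∂(Measure.pi fun _ : Fin n => areaMeasure)

/-- Partition function of the Pfaffian Coulomb gas of `n` particles with potential `V`:
`∫ ∏_{j>k} |z_j - z_k|² |z_j - conj z_k|² ∏_j |z_j - conj z_j|² e^{-2 n V(z_j)} dA(z_1) ⋯ dA(z_n)`. -/
def partitionH (n : ℕ) (V : ℂ → ℝ) : ℝ :=
  ∫ z : Fin n → ℂ,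
    (∏ j : Fin n, ∏ k ∈ Finset.Iio j,
        (‖z j - z k‖ ^ 2 * ‖z j - (starRingEnd ℂ) (z k)‖ ^ 2)) *
      ∏ j : Fin n,
        (‖z j - (starRingEnd ℂ) (z j)‖ ^ 2 * exp (-(2 * (n : ℝ) * V (z j))))
    ∂(Measure.pi fun _ : Fin n => areaMeasure)

/-- The external potential
`Q_n(z) = ((n + α + c + 1) / n) log (1 + |z|²) - (2 c / n) log |z|`
of the induced spherical ensembles. -/
def potential (α c n : ℕ) (z : ℂ) : ℝ :=
  ((n : ℝ) + α + c + 1) / n * log (1 + ‖z‖ ^ 2) - 2 * (c : ℝ) / n * log ‖z‖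

/-- Partition function `Z_n^ℂ` of the complex induced spherical ensemble. -/
def ZC (α c n : ℕ) : ℝ := partitionC n (potential α c n)

/-- Partition function `Z_n^ℍ` of the symplectic induced spherical ensemble. -/
def ZH (α c n : ℕ) : ℝ := partitionH n (potential α c n)

/-- The Barnes `G`-function on the real line, by its Weierstrass product
`G(1 + z) = (2π)^{z/2} exp (-(z + (1 + γ) z²) / 2) ∏_{k ≥ 1} (1 + z/k)^k exp (z²/(2k) - z)`
with `γ` the Euler–Mascheroni constant; it satisfies `G(x + 1) = Γ(x) G(x)` and `G(1) = 1`. -/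
def barnesG (x : ℝ) : ℝ :=
  (2 * π) ^ ((x - 1) / 2) *
    exp (-((x - 1) + (1 + eulerMascheroniConstant) * (x - 1) ^ 2) / 2) *
    ∏' k : ℕ, (1 + (x - 1) / ((k : ℝ) + 1)) ^ (k + 1) *
      exp ((x - 1) ^ 2 / (2 * ((k : ℝ) + 1)) - (x - 1))

/-- The real number `ζ'(-1)`, with `ζ` the Riemann zeta function. -/
def zetaDerivNegOne : ℝ := (deriv riemannZeta (-1)).re

end InducedSpherical

end

/-!
Both partition functions are explicit products of factorials.

In the complex case the squared Vandermonde product is `det · conj det`. Expanding both determinants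
by Leibniz and integrating variable by variable leaves only mixed moments `∫ z^a z̄^b w`, which
vanish for `a ≠ b` because the weight `w(z) = |z|^{2c} / (1 + |z|²)^{n+α+c+1}` is radial. Hence
`Z_n^ℂ = n! ∏_k h_k`, where `h_k` is a beta integral (`ZC_eq`).

In the symplectic case the integrand is the Vandermonde product of the `2n` points `z_j, z̄_j` times
`∏ (z_j - z̄_j) w(z_j)`, with `w` now the square of the weight above and `h_k` its moments. After a
Leibniz expansion the skew products `∫ z^a z̄^b (z - z̄) w` vanish
unless `|a - b| = 1`. A permutation all of whose pairs consist of neighbours must preserve the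
partition of `{0, …, 2n-1}` into `{2k, 2k+1}` (`fst_eq_of_adjacent`), so the surviving terms all
equal `∏_k h_{2k+1}` and there are `n! 2^n` of them (`ZH_eq`).

The logarithms are therefore combinations of `log m!`, of `∑_{j<m} log j!` and of
`∑_{j<m} log (2j+1)!`. The last two reduce to `log m!` and to the hyperfactorial `∑_{j≤m} j log j`.
A corrected trapezoidal rule (`norm_trapezoid_corrected_le`) gives Stirling's formula
(`log_factorial_isBigO`) and the expansion of the hyperfactorial up to its constant. The same rule
applied to `x ↦ x^{-s}` continues `ζ` to a convex region containing `-1`; differentiating there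
identifies that constant as `1/12 - ζ'(-1)` (`logHyperfactorial_isBigO`).

The terms independent of `n` involve `G(c+1)` and `G(c+3/2)`. They are obtained from the functional
equation `G(x+1) = Γ(x) G(x)` (`log_barnesG_add_one`), the duplication formula for `Γ`, and the
value `G(3/2)` (`log_barnesG_three_halves`). The functional equation and the special value are read
off from the Weierstrass product, whose partial products are elementary combinations of factorials,
hyperfactorials and harmonic numbers.
-/

noncomputable section

namespace InducedSpherical

/-! ### Moments of a radial weight -/

/-- The beta integral in the variable `r² = t`, by integration by parts in the exponent `p`. -/
lemma integrableOn_and_integral_pow_div_one_add_sq_pow (p q : ℕ) :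
    IntegrableOn (fun r : ℝ => r ^ (2 * p + 1) / (1 + r ^ 2) ^ (p + q + 2)) (Set.Ioi 0) ∧
    ∫ r in Set.Ioi (0 : ℝ), r ^ (2 * p + 1) / (1 + r ^ 2) ^ (p + q + 2)
      = (p.factorial * q.factorial : ℝ) / (2 * (p + q + 1).factorial) := by
  have hlim : Tendsto (fun r : ℝ => (1 + r ^ 2)⁻¹) atTop (nhds 0) :=
    (tendsto_atTop_add_const_left _ _ (tendsto_pow_atTop two_ne_zero)).inv_tendsto_atTop
  induction p with
  | zero =>
    have hd : ∀ r ∈ Set.Ici (0 : ℝ), HasDerivAt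
        (fun r : ℝ => -(1 / (2 * (q + 1 : ℝ))) * ((1 + r ^ 2)⁻¹) ^ (q + 1))
        (r ^ (2 * 0 + 1) / (1 + r ^ 2) ^ (0 + q + 2)) r := by
      intro r _
      have h0 : (1 + r ^ 2) ≠ 0 := by positivity
      have h1 : HasDerivAt (fun r : ℝ => 1 + r ^ 2) (2 * r) r := by
        simpa using (hasDerivAt_pow 2 r).const_add 1
      refine ((h1.inv h0).pow (q + 1)).const_mul _ |>.congr_deriv ?_
      have : (q + 1 : ℝ) ≠ 0 := by positivity
      simp only [Pi.inv_apply, inv_pow, Nat.add_sub_cancel, Nat.cast_add, Nat.cast_one]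
      field_simp
      ring
    have ht : Tendsto (fun r : ℝ => -(1 / (2 * (q + 1 : ℝ))) * ((1 + r ^ 2)⁻¹) ^ (q + 1)) atTop
        (nhds 0) := by
      simpa using (hlim.pow (q + 1)).const_mul (-(1 / (2 * (q + 1 : ℝ))))
    have hp : ∀ r ∈ Set.Ioi (0 : ℝ), 0 ≤ r ^ (2 * 0 + 1) / (1 + r ^ 2) ^ (0 + q + 2) := by
      intro r hr
      have : (0 : ℝ) < r := hr
      positivity
    refine ⟨integrableOn_Ioi_deriv_of_nonneg' hd hp ht, ?_⟩
    rw [integral_Ioi_of_hasDerivAt_of_nonneg' hd hp ht]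
    simp only [zero_add, Nat.factorial_succ q, Nat.factorial_zero]
    have h2 : (q.factorial : ℝ) ≠ 0 := by positivity
    have h3 : (q + 1 : ℝ) ≠ 0 := by positivity
    push_cast
    field_simp
    simp
  | succ p ih =>
    obtain ⟨hi, he⟩ := ih
    have hcont : Continuous fun r : ℝ =>
        r ^ (2 * (p + 1) + 1) / (1 + r ^ 2) ^ (p + 1 + q + 2) :=
      by fun_prop (disch := intro; positivity)
    have hint : IntegrableOn (fun r : ℝ =>
        r ^ (2 * (p + 1) + 1) / (1 + r ^ 2) ^ (p + 1 + q + 2)) (Set.Ioi 0) := by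
      refine Integrable.mono' hi hcont.aestronglyMeasurable ?_
      refine (ae_restrict_iff' measurableSet_Ioi).mpr (ae_of_all _ fun r hr => ?_)
      have hr : (0 : ℝ) < r := hr
      rw [Real.norm_of_nonneg (by positivity), div_le_div_iff₀ (by positivity) (by positivity)]
      have : 0 ≤ r ^ (2 * p + 1) * (1 + r ^ 2) ^ (p + q + 2) := by positivity
      calc _ = r ^ (2 * p + 1) * (1 + r ^ 2) ^ (p + q + 2) * r ^ 2 := by ring
        _ ≤ r ^ (2 * p + 1) * (1 + r ^ 2) ^ (p + q + 2) * (1 + r ^ 2) := by gcongr; linarith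
        _ = _ := by ring
    refine ⟨hint, ?_⟩
    have hd : ∀ r ∈ Set.Ici (0 : ℝ), HasDerivAt
        (fun r : ℝ => r ^ (2 * p + 2) * ((1 + r ^ 2)⁻¹) ^ (p + q + 2))
        ((2 * p + 2) * (r ^ (2 * p + 1) / (1 + r ^ 2) ^ (p + q + 2))
          - 2 * (p + q + 2) * (r ^ (2 * (p + 1) + 1) / (1 + r ^ 2) ^ (p + 1 + q + 2))) r := by
      intro r _
      have h0 : (1 + r ^ 2) ≠ 0 := by positivity
      have h1 : HasDerivAt (fun r : ℝ => 1 + r ^ 2) (2 * r) r := by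
        simpa using (hasDerivAt_pow 2 r).const_add 1
      refine ((hasDerivAt_pow (2 * p + 2) r).mul ((h1.inv h0).pow (p + q + 2))).congr_deriv ?_
      simp only [Pi.inv_apply, inv_pow, Nat.cast_add, Nat.cast_mul, Nat.cast_ofNat,
        Pi.pow_apply, show 2 * p + 2 - 1 = 2 * p + 1 by omega,
        show p + q + 2 - 1 = p + q + 1 by omega]
      field_simp
      ring
    have ht : Tendsto (fun r : ℝ => r ^ (2 * p + 2) * ((1 + r ^ 2)⁻¹) ^ (p + q + 2)) atTop
        (nhds 0) := by
      refine squeeze_zero (fun r => ?_) (fun r => ?_) hlim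
      · rw [show 2 * p + 2 = 2 * (p + 1) by ring, pow_mul]
        positivity
      · have h0 : (0 : ℝ) < 1 + r ^ 2 := by positivity
        rw [show 2 * p + 2 = 2 * (p + 1) by ring, pow_mul, inv_pow, ← div_eq_mul_inv,
          div_le_iff₀ (by positivity)]
        calc (r ^ 2) ^ (p + 1) ≤ (1 + r ^ 2) ^ (p + 1) := by gcongr; linarith
          _ ≤ (1 + r ^ 2) ^ (p + q + 1) := pow_le_pow_right₀ (by nlinarith [sq_nonneg r]) (by omega)
          _ = (1 + r ^ 2)⁻¹ * (1 + r ^ 2) ^ (p + q + 2) := by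
            field_simp
            ring
    have hI := integral_Ioi_of_hasDerivAt_of_tendsto' hd
      ((hi.const_mul _).sub (hint.const_mul _)) ht
    rw [integral_sub (hi.const_mul _) (hint.const_mul _), integral_const_mul, integral_const_mul,
      he] at hI
    have h3 : (p + q + 2 : ℝ) ≠ 0 := by positivity
    have h4 : (p + 1 : ℝ) ≠ 0 := by positivity
    have h5 : ((p + q + 1).factorial : ℝ) ≠ 0 := by positivity
    rw [show p + 1 + q + 1 = (p + q + 1) + 1 by ring, Nat.factorial_succ p,
      Nat.factorial_succ (p + q + 1)]
    push_cast
    simp only [ne_eq, Nat.add_eq_zero_iff, mul_eq_zero, OfNat.ofNat_ne_zero, and_false,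
      not_false_eq_true, zero_pow, zero_mul, sub_zero] at hI
    field_simp at hI ⊢
    linear_combination (-1 : ℝ) * hI

/-- The radial weight `|z|^{2c} / (1 + |z|²)^M` on the plane. -/
def weight (c M : ℕ) (z : ℂ) : ℝ := ‖z‖ ^ (2 * c) / (1 + ‖z‖ ^ 2) ^ M

lemma integral_areaMeasure {E : Type*} [NormedAddCommGroup E] [NormedSpace ℝ E] (f : ℂ → E) :
    ∫ z, f z ∂areaMeasure = π⁻¹ • ∫ z, f z := by
  rw [areaMeasure, integral_smul_nnreal_measure]
  rfl

lemma integrable_areaMeasure {E : Type*} [NormedAddCommGroup E] {f : ℂ → E}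
    (hf : Integrable f) : Integrable f areaMeasure := by
  rw [areaMeasure]
  exact hf.smul_measure_nnreal

lemma integrable_norm_pow_mul_weight (c M k : ℕ) (h : k + 2 * c + 3 ≤ 2 * M) :
    Integrable (fun z : ℂ => ‖z‖ ^ k * weight c M z) := by
  unfold weight
  rw [integrable_fun_norm_addHaar (μ := (volume : Measure ℂ))
    (f := fun r : ℝ => r ^ k * (r ^ (2 * c) / (1 + r ^ 2) ^ M))]
  refine Integrable.mono' (integrable_inv_one_add_sq.integrableOn (s := Set.Ioi 0))
    ((Continuous.aestronglyMeasurable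
      (by fun_prop (disch := intro; positivity)))) ?_
  refine (ae_restrict_iff' measurableSet_Ioi).mpr (ae_of_all _ fun r hr => ?_)
  have hr : (0 : ℝ) < r := hr
  have h0 : (0 : ℝ) < 1 + r ^ 2 := by positivity
  have h1 : (1 : ℝ) ≤ 1 + r ^ 2 := by nlinarith [sq_nonneg r]
  rw [Real.norm_of_nonneg (by simp only [smul_eq_mul]; positivity), Complex.finrank_real_complex,
    smul_eq_mul]
  have key : r ^ (k + 2 * c + 1) ≤ (1 + r ^ 2) ^ (M - 1) := by
    refine (pow_le_pow_iff_left₀ (by positivity) (by positivity) two_ne_zero).mp ?_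
    calc (r ^ (k + 2 * c + 1)) ^ 2 = (r ^ 2) ^ (k + 2 * c + 1) := by ring
      _ ≤ (1 + r ^ 2) ^ (k + 2 * c + 1) := by gcongr; linarith
      _ ≤ (1 + r ^ 2) ^ ((M - 1) * 2) := pow_le_pow_right₀ h1 (by omega)
      _ = _ := by rw [pow_mul]
  obtain ⟨N, rfl⟩ : ∃ N, M = N + 1 := ⟨M - 1, by omega⟩
  calc _ = r ^ (k + 2 * c + 1) / (1 + r ^ 2) ^ (N + 1) := by ring
    _ ≤ (1 + r ^ 2) ^ N / (1 + r ^ 2) ^ (N + 1) := by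
      gcongr
      simpa using key
    _ = (1 + r ^ 2)⁻¹ := by
      field_simp
      ring

lemma integral_norm_sq_pow_mul_weight (c M k : ℕ) (h : k + c + 2 ≤ M) :
    ∫ z, ‖z‖ ^ (2 * k) * weight c M z ∂areaMeasure
      = ((k + c).factorial * (M - (k + c + 2)).factorial : ℝ) / (M - 1).factorial := by
  obtain ⟨q, rfl⟩ := Nat.exists_eq_add_of_le h
  rw [integral_areaMeasure]
  unfold weight
  rw [integral_fun_norm_addHaar (μ := (volume : Measure ℂ))
    (f := fun r : ℝ => r ^ (2 * k) * (r ^ (2 * c) / (1 + r ^ 2) ^ (k + c + 2 + q)))]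
  have h1 := (integrableOn_and_integral_pow_div_one_add_sq_pow (k + c) q).2
  rw [show k + c + 2 + q - (k + c + 2) = q by omega,
    show k + c + 2 + q - 1 = k + c + q + 1 by omega, Complex.finrank_real_complex]
  have h2 : ∀ r : ℝ, r ^ (2 - 1) • (r ^ (2 * k) * (r ^ (2 * c) / (1 + r ^ 2) ^ (k + c + 2 + q)))
      = r ^ (2 * (k + c) + 1) / (1 + r ^ 2) ^ (k + c + q + 2) := by
    intro r
    rw [smul_eq_mul, show k + c + 2 + q = k + c + q + 2 by omega]
    ring
  simp only [h2]
  rw [h1]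
  have hv : (volume : Measure ℂ).real (Metric.ball 0 1) = π := by
    simp [Measure.real, Complex.volume_ball]
  rw [hv]
  have := Real.pi_pos.ne'
  simp only [smul_eq_mul, nsmul_eq_mul]
  push_cast
  field_simp

/-- The integrand of the mixed moment of order `(a, b)` of the radial weight. -/
def momentIntegrand (c M a b : ℕ) (z : ℂ) : ℂ :=
  z ^ a * (starRingEnd ℂ z) ^ b * (weight c M z : ℂ)

lemma continuous_weight (c M : ℕ) : Continuous (weight c M) := by
  unfold weight
  fun_prop (disch := intro; positivity)

lemma integrable_momentIntegrand (c M a b : ℕ) (h : a + b + 2 * c + 3 ≤ 2 * M) :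
    Integrable (momentIntegrand c M a b) areaMeasure := by
  refine integrable_areaMeasure
    ((integrable_norm_pow_mul_weight c M (a + b) h).mono' ?_ (ae_of_all _ fun z => ?_))
  · have := continuous_weight c M
    unfold momentIntegrand
    exact Continuous.aestronglyMeasurable (by fun_prop)
  · have : 0 ≤ weight c M z := by unfold weight; positivity
    simp [momentIntegrand, abs_of_nonneg this, pow_add]

/-- Mixed moments of a radial weight vanish off the diagonal: a rotation through an angle
`π / (a - b)` changes the sign of the integrand. -/
lemma integral_momentIntegrand_of_ne (c M a b : ℕ) (h : a ≠ b) :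
    ∫ z, momentIntegrand c M a b z ∂areaMeasure = 0 := by
  rw [integral_areaMeasure]
  set θ : ℝ := π / ((a : ℝ) - b) with hθ
  have hab : ((a : ℝ) - b) ≠ 0 := sub_ne_zero.mpr (by exact_mod_cast h)
  have hrot := (rotation (Circle.exp θ)).measurePreserving.integral_comp
    (rotation (Circle.exp θ)).toHomeomorph.measurableEmbedding (momentIntegrand c M a b)
  -- The rotation multiplies `z ^ a * conj z ^ b` by `exp (i θ (a - b)) = -1`.
  have hpt : ∀ z, momentIntegrand c M a b (rotation (Circle.exp θ) z)
      = - momentIntegrand c M a b z := by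
    intro z
    have hw : weight c M (rotation (Circle.exp θ) z) = weight c M z := by
      simp [weight]
    have hu : ((Circle.exp θ : ℂ)) ^ a * (starRingEnd ℂ (Circle.exp θ : ℂ)) ^ b = -1 := by
      rw [Circle.coe_exp, ← Complex.exp_conj, ← Complex.exp_nat_mul, ← Complex.exp_nat_mul,
        ← Complex.exp_add, ← Complex.exp_pi_mul_I]
      congr 1
      simp only [map_mul, Complex.conj_ofReal, Complex.conj_I]
      have : ((a : ℂ) - b) * θ = π := by
        have : ((a : ℝ) - b) * θ = π := by rw [hθ]; field_simp
        exact_mod_cast this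
      linear_combination Complex.I * this
    simp only [momentIntegrand]
    rw [hw, rotation_apply, map_mul, mul_pow, mul_pow]
    linear_combination (z ^ a * (starRingEnd ℂ z) ^ b * (weight c M z : ℂ)) * hu
  simp only [hpt] at hrot
  rw [integral_neg, neg_eq_iff_add_eq_zero, ← two_mul] at hrot
  rcases mul_eq_zero.mp hrot with h | h
  · norm_num at h
  · rw [h, smul_zero]

lemma integral_momentIntegrand_self (c M k : ℕ) (h : k + c + 2 ≤ M) :
    ∫ z, momentIntegrand c M k k z ∂areaMeasure
      = (((k + c).factorial * (M - (k + c + 2)).factorial / (M - 1).factorial : ℝ) : ℂ) := by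
  rw [← integral_norm_sq_pow_mul_weight c M k h, ← integral_complex_ofReal]
  refine integral_congr_ae (ae_of_all _ fun z => ?_)
  simp only [momentIntegrand]
  rw [← mul_pow, Complex.mul_conj, Complex.normSq_eq_norm_sq, pow_mul]
  push_cast
  ring

/-! ### The determinantal partition function -/

/-- At the origin the two sides differ when `c > 0`, because `log 0 = 0`; this is a null set. -/
lemma exp_neg_mul_potential {n : ℕ} (hn : n ≠ 0) (α c : ℕ) {z : ℂ} (hz : z ≠ 0) :
    exp (-((n : ℝ) * potential α c n z)) = weight c (n + α + c + 1) z := by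
  have hz' : 0 < ‖z‖ := norm_pos_iff.mpr hz
  have hn' : (n : ℝ) ≠ 0 := by exact_mod_cast hn
  have h1 : -((n : ℝ) * potential α c n z)
      = (2 * c : ℕ) * log ‖z‖ - (n + α + c + 1 : ℕ) * log (1 + ‖z‖ ^ 2) := by
    unfold potential
    push_cast
    field_simp
    ring
  rw [h1, exp_sub, exp_nat_mul, exp_nat_mul, exp_log hz', exp_log (by positivity), weight]

lemma exp_neg_two_mul_potential {n : ℕ} (hn : n ≠ 0) (α c : ℕ) {z : ℂ} (hz : z ≠ 0) :
    exp (-(2 * (n : ℝ) * potential α c n z)) = weight (2 * c) (2 * (n + α + c + 1)) z := by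
  have h := exp_neg_mul_potential hn α c hz
  rw [show -(2 * (n : ℝ) * potential α c n z) = (2 : ℕ) * -((n : ℝ) * potential α c n z) by
    push_cast; ring, exp_nat_mul, h, weight, weight, div_pow, ← pow_mul, ← pow_mul]
  ring_nf

lemma ae_pi_ne_zero (n : ℕ) :
    ∀ᵐ z : Fin n → ℂ ∂(Measure.pi fun _ => areaMeasure), ∀ j, z j ≠ 0 := by
  refine ae_all_iff.mpr fun j => ?_
  have h0 : ∀ᵐ x ∂areaMeasure, x ≠ (0 : ℂ) := by
    rw [areaMeasure]
    exact Measure.ae_smul_measure (Measure.ae_ne volume 0) _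
  exact (Measure.quasiMeasurePreserving_eval (fun _ : Fin n => areaMeasure) j).ae h0

/-- The Leibniz expansion of the Vandermonde product. -/
lemma prod_sub_eq_sum_perm {n : ℕ} (v : Fin n → ℂ) :
    ∏ j : Fin n, ∏ k ∈ Finset.Iio j, (v j - v k)
      = ∑ σ : Equiv.Perm (Fin n), ((Equiv.Perm.sign σ : ℤ) : ℂ) * ∏ i, v i ^ (σ i : ℕ) := by
  have h := Matrix.det_apply' (Matrix.vandermonde v).transpose
  rw [Matrix.det_transpose, Matrix.det_vandermonde] at h
  simp only [Matrix.transpose_apply, Matrix.vandermonde_apply] at h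
  rw [← h]
  exact Finset.prod_comm' (by simp)

lemma integral_sum_mul_prod {n : ℕ} {κ : Type*} [Fintype κ] (a : κ → ℂ)
    (f : κ → Fin n → ℂ → ℂ) (hf : ∀ s j, Integrable (f s j) areaMeasure) :
    ∫ z : Fin n → ℂ, ∑ s, a s * ∏ j, f s j (z j) ∂(Measure.pi fun _ => areaMeasure)
      = ∑ s, a s * ∏ j, ∫ z, f s j z ∂areaMeasure := by
  rw [integral_finsetSum _ fun s _ => (Integrable.fintype_prod (hf s)).const_mul _]
  refine Finset.sum_congr rfl fun s _ => ?_
  rw [integral_const_mul, integral_fintype_prod_eq_prod]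

theorem ZC_eq {n : ℕ} (hn : n ≠ 0) (α c : ℕ) :
    ZC α c n = n.factorial * ∏ k : Fin n,
      (((k + c).factorial * (n + α + c + 1 - (k + c + 2)).factorial : ℝ)
        / (n + α + c).factorial) := by
  set M := n + α + c + 1 with hM
  have key : ((ZC α c n : ℝ) : ℂ) = ∑ s : Equiv.Perm (Fin n) × Equiv.Perm (Fin n),
      (((Equiv.Perm.sign s.1 : ℤ) : ℂ) * ((Equiv.Perm.sign s.2 : ℤ) : ℂ))
        * ∏ j, ∫ z, momentIntegrand c M (s.1 j) (s.2 j) z ∂areaMeasure := by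
    rw [← integral_sum_mul_prod _ (fun (s : Equiv.Perm (Fin n) × Equiv.Perm (Fin n)) j =>
      momentIntegrand c M (s.1 j) (s.2 j))
      (fun s j => integrable_momentIntegrand _ _ _ _ (by omega)), ZC, partitionC,
      ← integral_complex_ofReal]
    refine integral_congr_ae ?_
    filter_upwards [ae_pi_ne_zero n] with z hz
    have hw : ∏ j, exp (-((n : ℝ) * potential α c n (z j))) = ∏ j, weight c M (z j) :=
      Finset.prod_congr rfl fun j _ => exp_neg_mul_potential hn α c (hz j)
    have hv : ((∏ j : Fin n, ∏ k ∈ Finset.Iio j, ‖z j - z k‖ ^ 2 : ℝ) : ℂ)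
        = (∏ j : Fin n, ∏ k ∈ Finset.Iio j, (z j - z k))
          * ∏ j : Fin n, ∏ k ∈ Finset.Iio j, (starRingEnd ℂ (z j) - starRingEnd ℂ (z k)) := by
      push_cast
      simp only [← Finset.prod_mul_distrib, ← map_sub, Complex.mul_conj, Complex.normSq_eq_norm_sq]
      push_cast
      rfl
    rw [hw, Complex.ofReal_mul, hv, prod_sub_eq_sum_perm, prod_sub_eq_sum_perm (fun j =>
      starRingEnd ℂ (z j)), Finset.sum_mul_sum, Finset.sum_mul, Fintype.sum_prod_type]
    refine Finset.sum_congr rfl fun σ _ => ?_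
    rw [Finset.sum_mul]
    refine Finset.sum_congr rfl fun τ _ => ?_
    simp only [momentIntegrand, Finset.prod_mul_distrib]
    push_cast
    ring
  have hmom : ∀ a b : Fin n, ∫ z, momentIntegrand c M a b z ∂areaMeasure
      = if a = b then ((((a + c).factorial * (M - (a + c + 2)).factorial
          / (n + α + c).factorial : ℝ)) : ℂ) else 0 := by
    intro a b
    split_ifs with h
    · rw [h, integral_momentIntegrand_self _ _ _ (by omega)]
      rfl
    · exact integral_momentIntegrand_of_ne _ _ _ _ (fun h' => h (Fin.ext h'))
  -- By orthogonality only `τ = σ` survives in the double sum.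
  have hsum : ∀ σ : Equiv.Perm (Fin n), ∑ τ : Equiv.Perm (Fin n),
      (((Equiv.Perm.sign σ : ℤ) : ℂ) * ((Equiv.Perm.sign τ : ℤ) : ℂ))
        * ∏ j, ∫ z, momentIntegrand c M (σ j) (τ j) z ∂areaMeasure
      = ∏ k : Fin n, ((((k + c).factorial * (M - (k + c + 2)).factorial
          / (n + α + c).factorial : ℝ)) : ℂ) := by
    intro σ
    rw [Finset.sum_eq_single σ]
    · rw [← Int.cast_mul, Int.units_coe_mul_self, Int.cast_one, one_mul]
      refine Eq.trans (Finset.prod_congr rfl fun j _ => by rw [hmom, if_pos rfl])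
        (Equiv.prod_comp σ fun k : Fin n => ((((k + c).factorial * (M - (k + c + 2)).factorial
          / (n + α + c).factorial : ℝ)) : ℂ))
    · intro τ _ hτ
      obtain ⟨j, hj⟩ : ∃ j, σ j ≠ τ j := by
        by_contra! h
        exact hτ (Equiv.ext fun j => (h j).symm)
      rw [Finset.prod_eq_zero (Finset.mem_univ j) (by rw [hmom, if_neg hj]), mul_zero]
    · simp
  rw [Fintype.sum_prod_type, Finset.sum_congr rfl fun σ _ => hsum σ, Finset.sum_const,
    Finset.card_univ, Fintype.card_perm, Fintype.card_fin, nsmul_eq_mul] at key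
  exact_mod_cast key

/-! ### The Pfaffian partition function -/

/-- The exponent `2 k + b` attached to the index `(k, b)`. -/
def pairIndex {n : ℕ} (p : Fin n × Fin 2) : ℕ := 2 * p.1 + p.2

lemma pairIndex_lt {n : ℕ} (p : Fin n × Fin 2) : pairIndex p < 2 * n := by
  simp only [pairIndex]
  omega

/-- The Leibniz expansion of a Vandermonde product over points `x j`, `y j` taken in pairs. -/
lemma prod_pair_sub_eq_sum_perm {n : ℕ} (x y : Fin n → ℂ) :
    (∏ j : Fin n, ∏ k ∈ Finset.Iio j,
        ((x j - x k) * (y j - y k) * ((y j - x k) * (x j - y k)))) * ∏ j, (y j - x j)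
      = ∑ σ : Equiv.Perm (Fin n × Fin 2), ((Equiv.Perm.sign σ : ℤ) : ℂ)
          * ∏ j, (x j ^ pairIndex (σ (j, 0)) * y j ^ pairIndex (σ (j, 1))) := by
  set v : Fin n × Fin 2 → ℂ := fun p => if p.2 = 0 then x p.1 else y p.1 with hv
  set e : Fin n × Fin 2 ≃ Fin (n * 2) := finProdFinEquiv with he
  have hev : ∀ p, (e p : ℕ) = pairIndex p := fun p => by
    rw [he, finProdFinEquiv_apply_val, pairIndex, add_comm]
  have h := Matrix.det_apply' ((Matrix.vandermonde (v ∘ e.symm)).transpose.submatrix e e)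
  rw [Matrix.det_submatrix_equiv_self, Matrix.det_transpose, Matrix.det_vandermonde] at h
  simp only [Matrix.submatrix_apply, Matrix.transpose_apply, Matrix.vandermonde_apply,
    Function.comp_apply, Equiv.symm_apply_apply, hev, Fintype.prod_prod_type,
    Fin.prod_univ_two] at h
  have h1 : ∏ i : Fin (n * 2), ∏ j ∈ Finset.Ioi i, (v (e.symm j) - v (e.symm i))
      = ∏ q : Fin n × Fin 2, ∏ p : Fin n × Fin 2, if pairIndex p < pairIndex q
          then v q - v p else 1 := by
    rw [Finset.prod_comm' (t' := Finset.univ) (s' := fun j => Finset.Iio j) (by simp),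
      ← Equiv.prod_comp e]
    refine Finset.prod_congr rfl fun q _ => ?_
    rw [show Finset.Iio (e q) = Finset.univ.filter (· < e q) by ext; simp, Finset.prod_filter,
      ← Equiv.prod_comp e]
    refine Finset.prod_congr rfl fun p _ => ?_
    simp only [Equiv.symm_apply_apply, Fin.lt_def, hev]
  rw [h1] at h
  -- The factors between the pairs `k` and `j` in the ordered product over all `2n` points.
  have h2 : ∀ j k : Fin n, (∏ a : Fin 2, ∏ b : Fin 2,
      if pairIndex (k, b) < pairIndex (j, a) then v (j, a) - v (k, b) else 1)
      = (if k < j then ((x j - x k) * (y j - y k) * ((y j - x k) * (x j - y k))) else 1)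
        * (if k = j then y j - x j else 1) := by
    intro j k
    by_cases hkj : k = j
    · subst hkj
      simp [pairIndex, hv]
    · have hkj' : (k : ℕ) ≠ j := fun h => hkj (Fin.ext h)
      simp only [Fin.prod_univ_two, pairIndex, hv, Fin.lt_def, Fin.val_zero, Fin.val_one, hkj,
        if_true, if_false, one_ne_zero]
      split_ifs <;> first | omega | ring
  have h3 : (∏ q : Fin n × Fin 2, ∏ p : Fin n × Fin 2, if pairIndex p < pairIndex q
      then v q - v p else 1) = (∏ j : Fin n, ∏ k ∈ Finset.Iio j,
        ((x j - x k) * (y j - y k) * ((y j - x k) * (x j - y k)))) * ∏ j, (y j - x j) := by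
    simp_rw [Fintype.prod_prod_type]
    rw [← Finset.prod_mul_distrib]
    refine Finset.prod_congr rfl fun j _ => ?_
    rw [Finset.prod_comm]
    simp_rw [h2]
    rw [Finset.prod_mul_distrib, Finset.prod_ite_eq', if_pos (Finset.mem_univ j),
      ← Finset.prod_filter]
    congr 2
    ext
    simp
  rw [← h3, h]
  simp [hv]

/-- A fixed-point-free involution pairing neighbours in `{0, …, 2n-1}` pairs `2k` with `2k+1`. -/
lemma fst_eq_of_adjacent {n : ℕ} (f : Fin n × Fin 2 → Fin n × Fin 2)
    (hf : ∀ p, f (f p) = p)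
    (hadj : ∀ p, pairIndex (f p) = pairIndex p + 1 ∨ pairIndex p = pairIndex (f p) + 1) :
    ∀ p, (f p).1 = p.1 := by
  have main : ∀ k : ℕ, ∀ p : Fin n × Fin 2, (p.1 : ℕ) = k → (f p).1 = p.1 := by
    intro k
    induction k using Nat.strong_induction_on with
    | _ k ih =>
      have h0 : ∀ p : Fin n × Fin 2, (p.1 : ℕ) = k → (p.2 : ℕ) = 0 → (f p).1 = p.1 := by
        intro p hp hp2
        by_contra hne
        have ha := hadj p
        have hne' : ((f p).1 : ℕ) ≠ p.1 := fun h => hne (Fin.ext h)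
        simp only [pairIndex] at ha
        have hlt : ((f p).1 : ℕ) < k := by omega
        have := ih _ hlt (f p) rfl
        rw [hf] at this
        exact hne this.symm
      intro p hp
      rcases (by omega : (p.2 : ℕ) = 0 ∨ (p.2 : ℕ) = 1) with hp2 | hp2
      · exact h0 p hp hp2
      · have h1 := h0 (p.1, 0) hp rfl
        have ha := hadj (p.1, 0)
        have h1' : ((f (p.1, 0)).1 : ℕ) = p.1 := congrArg Fin.val h1
        simp only [pairIndex, Fin.val_zero] at ha
        have h2 : f (p.1, 0) = p := by
          ext
          · exact h1'
          · omega
        have h3 := hf (p.1, 0)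
        rw [h2] at h3
        rw [h3]
  exact fun p => main _ p rfl

/-- The permutation of `Fin n × Fin 2` that permutes the pairs by `τ` and acts inside
the `j`-th pair by `ε j`. -/
def pairPerm {n : ℕ} (s : Equiv.Perm (Fin n) × (Fin n → Equiv.Perm (Fin 2))) :
    Equiv.Perm (Fin n × Fin 2) :=
  (Equiv.prodCongrRight s.2).trans (Equiv.prodCongrLeft fun _ => s.1)

lemma pairPerm_apply {n : ℕ} (s : Equiv.Perm (Fin n) × (Fin n → Equiv.Perm (Fin 2)))
    (j : Fin n) (b : Fin 2) : pairPerm s (j, b) = (s.1 j, s.2 j b) := by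
  simp [pairPerm]

lemma pairPerm_injective {n : ℕ} : Function.Injective (pairPerm (n := n)) := by
  rintro ⟨τ, ε⟩ ⟨τ', ε'⟩ h
  have h1 : ∀ j b, (τ j, ε j b) = (τ' j, ε' j b) := fun j b => by
    rw [← pairPerm_apply (τ, ε), ← pairPerm_apply (τ', ε'), h]
  refine Prod.ext (Equiv.ext fun j => ?_) (funext fun j => Equiv.ext fun b => ?_)
  · exact congrArg Prod.fst (h1 j 0)
  · exact congrArg Prod.snd (h1 j b)

lemma sign_pairPerm {n : ℕ} (s : Equiv.Perm (Fin n) × (Fin n → Equiv.Perm (Fin 2))) :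
    Equiv.Perm.sign (pairPerm s) = ∏ j, Equiv.Perm.sign (s.2 j) := by
  have h : pairPerm s = (Equiv.prodCongrLeft fun _ => s.1) * Equiv.prodCongrRight s.2 := rfl
  rw [h, Equiv.Perm.sign_mul, Equiv.Perm.sign_prodCongrRight, Equiv.Perm.sign_prodCongrLeft]
  simp

/-- A permutation that keeps the two members of every pair together is a `pairPerm`. -/
lemma mem_range_pairPerm {n : ℕ} (σ : Equiv.Perm (Fin n × Fin 2))
    (h : ∀ j, (σ (j, 0)).1 = (σ (j, 1)).1) : σ ∈ Set.range (pairPerm (n := n)) := by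
  have hfst : ∀ j b, (σ (j, b)).1 = (σ (j, 0)).1 := by
    intro j b
    fin_cases b
    · rfl
    · exact (h j).symm
  have hτ : Function.Injective fun j => (σ (j, 0)).1 := by
    intro j j' hj
    simp only at hj
    by_contra hne
    have e1 : (σ (j, 0)).2 ≠ (σ (j, 1)).2 := fun e => by
      simpa using σ.injective (Prod.ext (h j) e)
    have e2 : (σ (j, 0)).2 ≠ (σ (j', 0)).2 := fun e => by
      simpa [hne] using σ.injective (Prod.ext hj e)
    have e3 : (σ (j, 1)).2 ≠ (σ (j', 0)).2 := fun e => by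
      simpa [hne] using σ.injective (Prod.ext ((h j).symm.trans hj) e)
    omega
  have hε : ∀ j, Function.Injective fun b => (σ (j, b)).2 := by
    intro j b b' hb
    have := σ.injective (Prod.ext ((hfst j b).trans (hfst j b').symm) hb)
    simpa using this
  refine ⟨(Equiv.ofBijective _ (Finite.injective_iff_bijective.mp hτ),
    fun j => Equiv.ofBijective _ (Finite.injective_iff_bijective.mp (hε j))), ?_⟩
  ext1 ⟨j, b⟩
  rw [pairPerm_apply]
  exact Prod.ext (hfst j b).symm rfl

/-- The integrand `z^a z̄^b (z - z̄) w(z)` of the skew product of two monomials. -/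
def skewIntegrand (c M a b : ℕ) (z : ℂ) : ℂ :=
  momentIntegrand c M (a + 1) b z - momentIntegrand c M a (b + 1) z

lemma integrable_skewIntegrand (c M a b : ℕ) (h : a + b + 2 * c + 4 ≤ 2 * M) :
    Integrable (skewIntegrand c M a b) areaMeasure :=
  (integrable_momentIntegrand _ _ _ _ (by omega)).sub
    (integrable_momentIntegrand _ _ _ _ (by omega))

lemma integral_skewIntegrand (c M a b : ℕ) (h : a + b + 2 * c + 4 ≤ 2 * M) :
    ∫ z, skewIntegrand c M a b z ∂areaMeasure
      = ∫ z, momentIntegrand c M (a + 1) b z ∂areaMeasure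
        - ∫ z, momentIntegrand c M a (b + 1) z ∂areaMeasure :=
  integral_sub (integrable_momentIntegrand _ _ _ _ (by omega))
    (integrable_momentIntegrand _ _ _ _ (by omega))

lemma integral_skewIntegrand_succ (c M k : ℕ) (h : k + c + 3 ≤ M) :
    ∫ z, skewIntegrand c M k (k + 1) z ∂areaMeasure
      = (((k + 1 + c).factorial * (M - (k + 1 + c + 2)).factorial
          / (M - 1).factorial : ℝ) : ℂ) := by
  rw [integral_skewIntegrand _ _ _ _ (by omega), integral_momentIntegrand_self _ _ _ (by omega),
    integral_momentIntegrand_of_ne _ _ _ _ (by omega), sub_zero]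

lemma integral_skewIntegrand_swap (c M a b : ℕ) (h : a + b + 2 * c + 4 ≤ 2 * M) :
    ∫ z, skewIntegrand c M b a z ∂areaMeasure
      = - ∫ z, skewIntegrand c M a b z ∂areaMeasure := by
  have hsymm : ∀ a b : ℕ, ∫ z, momentIntegrand c M a b z ∂areaMeasure
      = ∫ z, momentIntegrand c M b a z ∂areaMeasure := by
    intro a b
    by_cases h : a = b
    · rw [h]
    · rw [integral_momentIntegrand_of_ne _ _ _ _ h,
        integral_momentIntegrand_of_ne _ _ _ _ (Ne.symm h)]
  rw [integral_skewIntegrand _ _ _ _ (by omega), integral_skewIntegrand _ _ _ _ (by omega),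
    hsymm, hsymm b]
  ring

lemma integral_skewIntegrand_of_not_adjacent (c M a b : ℕ) (h : a + b + 2 * c + 4 ≤ 2 * M)
    (h1 : a ≠ b + 1) (h2 : b ≠ a + 1) :
    ∫ z, skewIntegrand c M a b z ∂areaMeasure = 0 := by
  rw [integral_skewIntegrand _ _ _ _ (by omega),
    integral_momentIntegrand_of_ne _ _ _ _ (by omega),
    integral_momentIntegrand_of_ne _ _ _ _ (by omega), sub_zero]

/-- Only permutations that keep the pairs `{2k, 2k+1}` together contribute to a Pfaffian-type sum
over a kernel `m` supported on neighbouring indices. -/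
lemma sum_perm_mul_prod_eq {n : ℕ} (m : ℕ → ℕ → ℂ)
    (hanti : ∀ k < n, m (2 * k + 1) (2 * k) = - m (2 * k) (2 * k + 1))
    (hadj : ∀ p q : Fin n × Fin 2, pairIndex p ≠ pairIndex q + 1 → pairIndex q ≠ pairIndex p + 1 →
      m (pairIndex p) (pairIndex q) = 0) :
    ∑ σ : Equiv.Perm (Fin n × Fin 2), ((Equiv.Perm.sign σ : ℤ) : ℂ)
        * ∏ j, m (pairIndex (σ (j, 0))) (pairIndex (σ (j, 1)))
      = n.factorial * 2 ^ n * ∏ k : Fin n, m (2 * k) (2 * k + 1) := by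
  symm
  -- `n! 2^n` counts the permutations `pairPerm s`.
  have hcard : (n.factorial * 2 ^ n * ∏ k : Fin n, m (2 * k) (2 * k + 1))
      = ∑ _s : Equiv.Perm (Fin n) × (Fin n → Equiv.Perm (Fin 2)),
        ∏ k : Fin n, m (2 * k) (2 * k + 1) := by
    rw [Finset.sum_const, Finset.card_univ, Fintype.card_prod, Fintype.card_perm, Fintype.card_fun,
      Fintype.card_perm, Fintype.card_fin, Fintype.card_fin, nsmul_eq_mul]
    simp
  rw [hcard]
  refine Fintype.sum_of_injective pairPerm pairPerm_injective _ _ (fun σ hσ => ?_) fun s => ?_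
  · by_contra hne
    have hprod := right_ne_zero_of_mul hne
    rw [Finset.prod_ne_zero_iff] at hprod
    have hnb : ∀ j, pairIndex (σ (j, 0)) = pairIndex (σ (j, 1)) + 1
        ∨ pairIndex (σ (j, 1)) = pairIndex (σ (j, 0)) + 1 := by
      intro j
      by_contra! hcon
      exact hprod j (Finset.mem_univ j) (hadj _ _ hcon.1 hcon.2)
    -- The involution sends `p` to the other member of the pair `{σ (j, 0), σ (j, 1)}` through `p`.
    have hfst := fst_eq_of_adjacent
      (fun p => σ ((σ.symm p).1, Equiv.swap 0 1 (σ.symm p).2)) (fun p => by simp) (fun p => by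
        obtain ⟨⟨j, b⟩, rfl⟩ := σ.surjective p
        have := hnb j
        fin_cases b <;> simp <;> tauto)
    refine hσ (mem_range_pairPerm σ fun j => ?_)
    simpa using hfst (σ (j, 1))
  · rw [sign_pairPerm]
    push_cast
    rw [← Equiv.prod_comp s.1, ← Finset.prod_mul_distrib]
    refine Finset.prod_congr rfl fun j _ => ?_
    rw [pairPerm_apply, pairPerm_apply]
    have hb : s.2 j = 1 ∨ s.2 j = Equiv.swap 0 1 := by
      generalize s.2 j = e
      revert e
      decide
    rcases hb with hb | hb
    · simp [hb, pairIndex]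
    · simp [hb, pairIndex, hanti _ (s.1 j).2]

theorem ZH_eq {n : ℕ} (hn : n ≠ 0) (α c : ℕ) :
    ZH α c n = n.factorial * 2 ^ n * ∏ k : Fin n,
      (((2 * (k + c) + 1).factorial * (2 * (n + α + c + 1) - (2 * (k + c) + 3)).factorial : ℝ)
        / (2 * (n + α + c) + 1).factorial) := by
  set M := 2 * (n + α + c + 1) with hM
  have key : ((ZH α c n : ℝ) : ℂ) = ∑ σ : Equiv.Perm (Fin n × Fin 2),
      ((Equiv.Perm.sign σ : ℤ) : ℂ) * ∏ j, ∫ z,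
        skewIntegrand (2 * c) M (pairIndex (σ (j, 0))) (pairIndex (σ (j, 1))) z ∂areaMeasure := by
    have hint : ∀ (σ : Equiv.Perm (Fin n × Fin 2)) (j : Fin n), Integrable (skewIntegrand (2 * c) M
        (pairIndex (σ (j, 0))) (pairIndex (σ (j, 1)))) areaMeasure := by
      intro σ j
      have h0 := pairIndex_lt (σ (j, 0))
      have h1 := pairIndex_lt (σ (j, 1))
      exact integrable_skewIntegrand _ _ _ _ (by omega)
    rw [← integral_sum_mul_prod _ _ hint, ZH, partitionH, ← integral_complex_ofReal]
    refine integral_congr_ae ?_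
    filter_upwards [ae_pi_ne_zero n] with z hz
    have hnorm : ∀ a b : ℂ, (a - b) * (starRingEnd ℂ a - starRingEnd ℂ b)
        = ((‖a - b‖ ^ 2 : ℝ) : ℂ) := by
      intro a b
      rw [← map_sub, Complex.mul_conj, Complex.normSq_eq_norm_sq]
    have hleib := prod_pair_sub_eq_sum_perm z (fun j => starRingEnd ℂ (z j))
    have h1 : ∀ j k, (z j - z k) * (starRingEnd ℂ (z j) - starRingEnd ℂ (z k))
        * ((starRingEnd ℂ (z j) - z k) * (z j - starRingEnd ℂ (z k)))
        = ((‖z j - z k‖ ^ 2 * ‖z j - starRingEnd ℂ (z k)‖ ^ 2 : ℝ) : ℂ) := by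
      intro j k
      have := hnorm (z j) (starRingEnd ℂ (z k))
      rw [Complex.conj_conj] at this
      rw [hnorm, mul_comm (starRingEnd ℂ (z j) - z k), this, Complex.ofReal_mul]
    simp only [h1] at hleib
    have h2 : ∀ j, ((‖z j - starRingEnd ℂ (z j)‖ ^ 2
          * exp (-(2 * (n : ℝ) * potential α c n (z j))) : ℝ) : ℂ)
        = (starRingEnd ℂ (z j) - z j)
          * ((z j - starRingEnd ℂ (z j)) * (weight (2 * c) M (z j) : ℂ)) := by
      intro j
      have := hnorm (z j) (starRingEnd ℂ (z j))
      rw [Complex.conj_conj] at this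
      rw [exp_neg_two_mul_potential hn α c (hz j), Complex.ofReal_mul, ← this]
      ring
    rw [Complex.ofReal_mul, Complex.ofReal_prod Finset.univ fun j =>
        ‖z j - starRingEnd ℂ (z j)‖ ^ 2 * exp (-(2 * (n : ℝ) * potential α c n (z j))),
      Finset.prod_congr rfl fun j _ => h2 j, Finset.prod_mul_distrib, ← mul_assoc]
    push_cast at hleib ⊢
    rw [hleib, Finset.sum_mul]
    refine Finset.sum_congr rfl fun σ _ => ?_
    rw [mul_assoc, ← Finset.prod_mul_distrib]
    congr 1
    refine Finset.prod_congr rfl fun j _ => ?_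
    simp only [skewIntegrand, momentIntegrand]
    ring
  rw [sum_perm_mul_prod_eq (fun a b => ∫ z, skewIntegrand (2 * c) M a b z ∂areaMeasure)] at key
  · have h3 : ∀ k : Fin n, ∫ z, skewIntegrand (2 * c) M (2 * k) (2 * k + 1) z ∂areaMeasure
        = (((2 * (k + c) + 1).factorial * (M - (2 * (k + c) + 3)).factorial
          / (2 * (n + α + c) + 1).factorial : ℝ) : ℂ) := by
      intro k
      rw [integral_skewIntegrand_succ _ _ _ (by omega),
        show 2 * (k : ℕ) + 1 + 2 * c = 2 * (k + c) + 1 by ring,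
        show M - 1 = 2 * (n + α + c) + 1 by omega]
    rw [Finset.prod_congr rfl fun k _ => h3 k] at key
    exact_mod_cast key
  · exact fun k hk => integral_skewIntegrand_swap _ _ _ _ (by omega)
  · intro p q h1 h2
    have hp := pairIndex_lt p
    have hq := pairIndex_lt q
    exact integral_skewIntegrand_of_not_adjacent _ _ _ _ (by omega) h1 h2

/-! ### Euler–Maclaurin summation, Stirling's formula and the hyperfactorial -/

/-- The error of the trapezoidal rule with the first Euler–Maclaurin correction; `f₁` is the
integrand, `f₀` a primitive of it, and `f₂`, `f₃`, `f₄` are its first three derivatives. -/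
lemma norm_trapezoid_corrected_le {E : Type*} [NormedAddCommGroup E] [NormedSpace ℝ E]
    {f₀ f₁ f₂ f₃ f₄ : ℝ → E} {a M : ℝ}
    (h₀ : ∀ x ∈ Set.Icc a (a + 1), HasDerivAt f₀ (f₁ x) x)
    (h₁ : ∀ x ∈ Set.Icc a (a + 1), HasDerivAt f₁ (f₂ x) x)
    (h₂ : ∀ x ∈ Set.Icc a (a + 1), HasDerivAt f₂ (f₃ x) x)
    (h₃ : ∀ x ∈ Set.Icc a (a + 1), HasDerivAt f₃ (f₄ x) x)
    (hM : ∀ x ∈ Set.Icc a (a + 1), ‖f₄ x‖ ≤ M) :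
    ‖f₀ (a + 1) - f₀ a - (1 / 2 : ℝ) • (f₁ a + f₁ (a + 1))
      + (1 / 12 : ℝ) • (f₂ (a + 1) - f₂ a)‖ ≤ M := by
  have hM0 : 0 ≤ M := (norm_nonneg _).trans (hM a ⟨le_rfl, by linarith⟩)
  have mv : ∀ (g g' : ℝ → E) (K : ℝ), 0 ≤ K → g a = 0 →
      (∀ x ∈ Set.Icc a (a + 1), HasDerivAt g (g' x) x) →
      (∀ x ∈ Set.Icc a (a + 1), ‖g' x‖ ≤ K) → ∀ x ∈ Set.Icc a (a + 1), ‖g x‖ ≤ K := by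
    intro g g' K hK hg hd hb x hx
    have h := norm_image_sub_le_of_norm_deriv_le_segment'
      (fun y hy => (hd y hy).hasDerivWithinAt) (fun y hy => hb y ⟨hy.1, hy.2.le⟩) x hx
    rw [hg, sub_zero] at h
    exact h.trans (mul_le_of_le_one_right hK (by linarith [hx.2]))
  have hid : ∀ x : ℝ, HasDerivAt (fun y : ℝ => y - a) 1 x := fun x => (hasDerivAt_id x).sub_const a
  have hsq : ∀ x : ℝ, HasDerivAt (fun y : ℝ => (y - a) ^ 2) (2 * (x - a)) x := fun x =>
    ((hid x).pow 2).congr_deriv (by simp)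
  have hu : ∀ x ∈ Set.Icc a (a + 1), |x - a| ≤ 1 := fun x hx => by
    rw [abs_of_nonneg (by linarith [hx.1])]
    linarith [hx.2]
  -- `s1` to `s3` let the right end of the interval vary: each function vanishes at `a` and its
  -- derivative is bounded by the step before.
  -- The first-order remainder of the Taylor expansion of `f₂` about `x`, evaluated at `a`.
  have s1 : ∀ x ∈ Set.Icc a (a + 1), ‖f₂ x - f₂ a - (x - a) • f₃ x‖ ≤ M := by
    refine mv _ (fun x => -((x - a) • f₄ x)) M hM0 (by simp) (fun x hx => ?_) fun x hx => ?_
    · refine (((h₂ x hx).sub_const _).sub ((hid x).smul (h₃ x hx))).congr_deriv ?_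
      module
    · rw [norm_neg, norm_smul]
      calc ‖x - a‖ * ‖f₄ x‖ ≤ 1 * M := mul_le_mul (hu x hx) (hM x hx) (norm_nonneg _) zero_le_one
        _ = M := one_mul M
  have s2 : ∀ x ∈ Set.Icc a (a + 1), ‖(1 / 2 : ℝ) • (f₁ x - f₁ a) - ((x - a) / 2) • f₂ x
      + ((x - a) / 6) • (f₂ x - f₂ a) + ((x - a) ^ 2 / 12) • f₃ x‖ ≤ M := by
    refine mv _ (fun x => (1 / 6 : ℝ) • (f₂ x - f₂ a - (x - a) • f₃ x)
      + ((x - a) ^ 2 / 12) • f₄ x) M hM0 (by simp) (fun x hx => ?_) fun x hx => ?_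
    · refine ((((((h₁ x hx).sub_const _).const_smul (1 / 2 : ℝ)).sub
        (((hid x).div_const 2).smul (h₂ x hx))).add
        (((hid x).div_const 6).smul ((h₂ x hx).sub_const _))).add
        (((hsq x).div_const 12).smul (h₃ x hx))).congr_deriv ?_
      module
    · refine (norm_add_le _ _).trans ?_
      rw [norm_smul, norm_smul]
      have e1 : ‖(x - a) ^ 2 / 12‖ ≤ 1 / 12 := by
        rw [norm_div, norm_pow, Real.norm_eq_abs, Real.norm_eq_abs,
          abs_of_pos (by norm_num : (0 : ℝ) < 12)]
        have := pow_le_one₀ (n := 2) (abs_nonneg _) (hu x hx)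
        linarith
      have e2 := mul_le_mul e1 (hM x hx) (norm_nonneg _) (by norm_num)
      have e3 := s1 x hx
      have e4 : ‖(1 / 6 : ℝ)‖ = 1 / 6 := by norm_num
      rw [e4]
      linarith
  have s3 := mv (fun x => f₀ x - f₀ a - ((x - a) / 2) • (f₁ a + f₁ x)
      + ((x - a) ^ 2 / 12) • (f₂ x - f₂ a)) (fun x => (1 / 2 : ℝ) • (f₁ x - f₁ a)
      - ((x - a) / 2) • f₂ x + ((x - a) / 6) • (f₂ x - f₂ a) + ((x - a) ^ 2 / 12) • f₃ x) M hM0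
    (by simp) (fun x hx => by
      refine ((((h₀ x hx).sub_const _).sub
        (((hid x).div_const 2).smul ((h₁ x hx).const_add _))).add
        (((hsq x).div_const 12).smul ((h₂ x hx).sub_const _))).congr_deriv ?_
      module) s2 (a + 1) ⟨by linarith, le_rfl⟩
  simpa using s3

/-- A sequence with increments `O(n^{-k-1})` converges, with error `O(n^{-k})`. -/
lemma exists_tendsto_of_abs_sub_le {f : ℕ → ℝ} {C : ℝ} (k : ℕ) (hk : k ≠ 0)
    (h : ∀ n : ℕ, n ≠ 0 → |f (n + 1) - f n| ≤ C / (n : ℝ) ^ (k + 1)) :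
    ∃ L, Tendsto f atTop (nhds L) ∧ (fun n => f n - L) =O[atTop] fun n => 1 / (n : ℝ) ^ k := by
  have hC : 0 ≤ C := by simpa using (abs_nonneg _).trans (h 1 one_ne_zero)
  set u : ℕ → ℝ := fun n => 1 / (n : ℝ) ^ k with hu
  -- The increments are dominated by those of the monotone sequence `u`, so the bounds telescope.
  have hstep : ∀ n : ℕ, n ≠ 0 → |f (n + 1) - f n| ≤ C * 2 ^ k * (u n - u (n + 1)) := by
    intro n hn
    have hn1 : (1 : ℝ) ≤ n := by exact_mod_cast Nat.one_le_iff_ne_zero.mpr hn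
    refine (h n hn).trans ?_
    rw [mul_assoc, div_eq_mul_one_div]
    refine mul_le_mul_of_nonneg_left ?_ hC
    have e1 : (n : ℝ) ^ k * (n + 1) ≤ n * (n + 1 : ℝ) ^ k := by
      obtain ⟨j, rfl⟩ : ∃ j, k = j + 1 := ⟨k - 1, by omega⟩
      have : (n : ℝ) ^ j ≤ (n + 1 : ℝ) ^ j := pow_le_pow_left₀ (by linarith) (by linarith) _
      calc (n : ℝ) ^ (j + 1) * (n + 1) = n * (n + 1) * (n : ℝ) ^ j := by ring
        _ ≤ n * (n + 1) * (n + 1 : ℝ) ^ j := by gcongr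
        _ = _ := by ring
    have e2 : (n + 1 : ℝ) ^ k ≤ 2 ^ k * (n : ℝ) ^ k := by
      rw [← mul_pow]
      exact pow_le_pow_left₀ (by linarith) (by linarith) _
    have hp : (0 : ℝ) < (n : ℝ) ^ k := by positivity
    have hq : (0 : ℝ) < (n + 1 : ℝ) ^ k := by positivity
    have e3 : u n - u (n + 1) = ((n + 1 : ℝ) ^ k - n ^ k) / (n ^ k * (n + 1 : ℝ) ^ k) := by
      simp only [hu]
      push_cast
      field_simp
    rw [e3, ← mul_div_assoc, div_le_div_iff₀ (by positivity) (by positivity)]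
    have e4 : (n : ℝ) ^ k ≤ n * ((n + 1 : ℝ) ^ k - n ^ k) := by linarith
    calc 1 * ((n : ℝ) ^ k * (n + 1 : ℝ) ^ k) ≤ 1 * (n ^ k * (2 ^ k * n ^ k)) := by gcongr
      _ = 2 ^ k * n ^ k * n ^ k := by ring
      _ ≤ 2 ^ k * n ^ k * (n * ((n + 1 : ℝ) ^ k - n ^ k)) := by gcongr
      _ = _ := by ring
  have hu0 : ∀ n, 0 ≤ u n := fun n => by positivity
  have hle : ∀ n : ℕ, n ≠ 0 → ∀ m, n ≤ m → |f m - f n| ≤ C * 2 ^ k * (u n - u m) := by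
    intro n hn m hm
    induction m, hm using Nat.le_induction with
    | base => simp
    | succ m hm ih =>
      have := hstep m (by omega)
      calc |f (m + 1) - f n| ≤ |f (m + 1) - f m| + |f m - f n| := abs_sub_le _ _ _
        _ ≤ _ := by linarith
  have hle' : ∀ n : ℕ, n ≠ 0 → ∀ m, n ≤ m → |f m - f n| ≤ C * 2 ^ k * u n := by
    intro n hn m hm
    refine (hle n hn m hm).trans ?_
    gcongr
    linarith [hu0 m]
  have hulim : Tendsto u atTop (nhds 0) := by
    have := (tendsto_pow_atTop hk).comp (tendsto_natCast_atTop_atTop (R := ℝ))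
    exact this.inv_tendsto_atTop.congr fun n => by simp [hu]
  have hcau : CauchySeq fun n => f (n + 1) := by
    refine cauchySeq_of_le_tendsto_0 (fun N => 2 * (C * 2 ^ k * u (N + 1)))
      (fun n m N hn hm => ?_) ?_
    · have e1 := hle' (N + 1) (by omega) (n + 1) (by omega)
      have e2 := hle' (N + 1) (by omega) (m + 1) (by omega)
      have e3 := abs_sub_le (f (n + 1)) (f (N + 1)) (f (m + 1))
      rw [abs_sub_comm] at e2
      rw [Real.dist_eq]
      linarith
    · have := ((hulim.comp (tendsto_add_atTop_nat 1)).const_mul (C * 2 ^ k)).const_mul 2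
      simpa using this
  obtain ⟨L, hL⟩ := cauchySeq_tendsto_of_complete hcau
  have hL' : Tendsto f atTop (nhds L) := (tendsto_add_atTop_iff_nat 1).mp hL
  refine ⟨L, hL', IsBigO.of_bound (C * 2 ^ k) ?_⟩
  filter_upwards [eventually_ne_atTop 0] with n hn
  have hlim : Tendsto (fun m => |f m - f n|) atTop (nhds |L - f n|) := (hL'.sub_const _).abs
  have := le_of_tendsto hlim (eventually_atTop.mpr ⟨n, hle' n hn⟩)
  rw [Real.norm_eq_abs, abs_sub_comm, Real.norm_of_nonneg (hu0 n)]
  exact this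

/-- Stirling's formula with the first correction term. -/
theorem log_factorial_isBigO :
    (fun n : ℕ => log n.factorial
      - ((n + 1 / 2) * log n - n + log (2 * π) / 2 + 1 / (12 * n)))
      =O[atTop] fun n : ℕ => 1 / (n : ℝ) ^ 2 := by
  set f : ℕ → ℝ := fun n => log n.factorial - ((n + 1 / 2) * log n - n + 1 / (12 * n)) with hf
  obtain ⟨L, hL, hO⟩ := exists_tendsto_of_abs_sub_le (f := f) (C := 2) 2 two_ne_zero (by
    intro n hn
    have hn0 : (0 : ℝ) < n := by exact_mod_cast Nat.pos_of_ne_zero hn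
    have hx : ∀ x ∈ Set.Icc (n : ℝ) (n + 1), x ≠ 0 := fun x hx => (hn0.trans_le hx.1).ne'
    have key := norm_trapezoid_corrected_le (a := (n : ℝ)) (M := 2 / (n : ℝ) ^ 3)
      (f₀ := fun x => x * log x - x) (f₁ := log) (f₂ := fun x => x⁻¹) (f₃ := fun x => -(x ^ 2)⁻¹)
      (f₄ := fun x => 2 / x ^ 3)
      (fun x h => ((hasDerivAt_mul_log (hx x h)).sub (hasDerivAt_id x)).congr_deriv (by ring))
      (fun x h => hasDerivAt_log (hx x h))
      (fun x h => hasDerivAt_inv (hx x h))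
      (fun x h => by
        refine (((hasDerivAt_pow 2 x).inv (pow_ne_zero 2 (hx x h))).neg).congr_deriv ?_
        have := hx x h
        field_simp
        push_cast
        ring)
      (fun x h => by
        have := hn0.trans_le h.1
        rw [Real.norm_of_nonneg (by positivity)]
        have := h.1
        gcongr)
    rw [Real.norm_eq_abs, ← abs_neg] at key
    refine le_of_eq_of_le (congrArg abs ?_) key
    have : (n : ℝ) + 1 ≠ 0 := by positivity
    have hn' : (n : ℝ) ≠ 0 := hn0.ne'
    simp only [hf, Nat.factorial_succ, smul_eq_mul]
    push_cast
    rw [log_mul (by positivity) (by positivity)]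
    field_simp
    ring)
  have hL2 : L = log (2 * π) / 2 := by
    have h1 : Tendsto (fun n => log (Stirling.stirlingSeq n) + log 2 / 2 - 1 / 12 * (1 / (n : ℝ)))
        atTop (nhds (log √π + log 2 / 2 - 1 / 12 * 0)) :=
      ((Stirling.tendsto_stirlingSeq_sqrt_pi.log (by positivity)).add_const _).sub
        (tendsto_one_div_atTop_nhds_zero_nat.const_mul _)
    refine (tendsto_nhds_unique (hL.congr' ?_) h1).trans ?_
    · filter_upwards [eventually_ne_atTop 0] with n hn
      have hn' : (n : ℝ) ≠ 0 := by exact_mod_cast hn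
      rw [Stirling.log_stirlingSeq_formula, log_mul two_ne_zero hn',
        log_div hn' (exp_ne_zero _), log_exp]
      simp only [hf]
      field_simp
      ring
    · rw [log_sqrt pi_pos.le, log_mul two_ne_zero pi_ne_zero]
      ring
  refine hO.congr_left fun n => ?_
  simp only [hf, hL2]
  ring

/-- The logarithm `∑_{j ≤ n} j log j` of the hyperfactorial. -/
def logHyperfactorial (n : ℕ) : ℝ := ∑ j ∈ Finset.range n, ((j : ℝ) + 1) * log (j + 1)

/-- The expansion of the hyperfactorial up to its constant term. -/
lemma exists_logHyperfactorial_isBigO :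
    ∃ L : ℝ, (fun n : ℕ => logHyperfactorial n
      - ((n ^ 2 / 2 + n / 2 + 1 / 12) * log n - n ^ 2 / 4 + L))
      =O[atTop] fun n : ℕ => 1 / (n : ℝ) := by
  set f : ℕ → ℝ := fun n => logHyperfactorial n
    - ((n ^ 2 / 2 + n / 2 + 1 / 12) * log n - n ^ 2 / 4) with hf
  obtain ⟨L, hL, hO⟩ := exists_tendsto_of_abs_sub_le (f := f) (C := 1) 1 one_ne_zero (by
    intro n hn
    have hn0 : (0 : ℝ) < n := by exact_mod_cast Nat.pos_of_ne_zero hn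
    have hx : ∀ x ∈ Set.Icc (n : ℝ) (n + 1), x ≠ 0 := fun x hx => (hn0.trans_le hx.1).ne'
    have key := norm_trapezoid_corrected_le (a := (n : ℝ)) (M := 1 / (n : ℝ) ^ 2)
      (f₀ := fun x => x ^ 2 / 2 * log x - x ^ 2 / 4) (f₁ := fun x => x * log x)
      (f₂ := fun x => log x + 1) (f₃ := fun x => x⁻¹)
      (f₄ := fun x => -(x ^ 2)⁻¹)
      (fun x h => by
        have hx0 := hx x h
        refine ((((hasDerivAt_pow 2 x).div_const 2).mul (hasDerivAt_log hx0)).sub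
          ((hasDerivAt_pow 2 x).div_const 4)).congr_deriv ?_
        field_simp
        norm_num
        ring)
      (fun x h => hasDerivAt_mul_log (hx x h))
      (fun x h => (hasDerivAt_log (hx x h)).add_const 1)
      (fun x h => hasDerivAt_inv (hx x h))
      (fun x h => by
        have := hn0.trans_le h.1
        rw [norm_neg, Real.norm_of_nonneg (by positivity), ← one_div]
        have := h.1
        gcongr)
    rw [Real.norm_eq_abs, ← abs_neg] at key
    refine le_of_eq_of_le (congrArg abs ?_) key
    simp only [hf, logHyperfactorial, Finset.sum_range_succ, smul_eq_mul]
    push_cast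
    ring)
  refine ⟨L, ?_⟩
  simp only [pow_one] at hO
  refine hO.congr_left fun n => ?_
  simp only [hf]
  ring

/-! ### The constant term of the hyperfactorial and `ζ'(-1)` -/

/-- The Euler–Maclaurin approximation to `ζ(s)` from the first `n + 1` terms of the series. -/
def zetaApprox (n : ℕ) (s : ℂ) : ℂ :=
  ∑ k ∈ Finset.range (n + 1), ((k + 1 : ℝ) : ℂ) ^ (-s)
    - ((n + 1 : ℝ) : ℂ) ^ (1 - s) / (1 - s) - ((n + 1 : ℝ) : ℂ) ^ (-s) / 2
    + s / 12 * ((n + 1 : ℝ) : ℂ) ^ (-s - 1)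

/-- A convex region that contains `-1` and meets the half-plane `Re s > 1` but avoids the pole of
`ζ`; continuation of `ζ` inside it needs no detour around the pole. -/
def continuationRegion : Set ℂ :=
  {s | -(3 / 2) < s.re} ∩ {s | s.re < s.im} ∩ Metric.ball 0 10

lemma isOpen_continuationRegion : IsOpen continuationRegion :=
  ((isOpen_lt continuous_const Complex.continuous_re).inter
    (isOpen_lt Complex.continuous_re Complex.continuous_im)).inter Metric.isOpen_ball

lemma isPreconnected_continuationRegion : IsPreconnected continuationRegion := by
  refine Convex.isPreconnected ?_
  refine ((convex_halfSpace_re_gt _).inter ?_).inter (convex_ball _ _)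
  intro x hx y hy a b ha hb hab
  simp only [Set.mem_ofPred_eq] at hx hy ⊢
  simp only [Complex.add_re, Complex.add_im, Complex.real_smul, Complex.re_ofReal_mul,
    Complex.im_ofReal_mul]
  rcases eq_or_lt_of_le ha with h | h
  · have : b = 1 := by linarith
    rw [← h, this]
    linarith
  · nlinarith

lemma ne_one_of_mem_continuationRegion {s : ℂ} (hs : s ∈ continuationRegion) : s ≠ 1 := by
  rintro rfl
  have := hs.1.2
  simp at this
  linarith

/-- Consecutive approximations differ by the error of the corrected trapezoidal rule for `x ↦ x^{-s}`;
the constant bounds `|s| |s+1| |s+2| ≤ 10 · 11 · 12`. -/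
lemma norm_zetaApprox_succ_sub_le (n : ℕ) {s : ℂ} (hs : s ∈ continuationRegion) :
    ‖zetaApprox (n + 1) s - zetaApprox n s‖ ≤ 1320 / ((n + 1 : ℕ) : ℝ) ^ (3 / 2 : ℝ) := by
  have hs1 : 1 - s ≠ 0 := sub_ne_zero.mpr (ne_one_of_mem_continuationRegion hs).symm
  have hre : -(3 / 2) < s.re := hs.1.1
  have hnorm : ‖s‖ ≤ 10 := by
    have := hs.2
    rw [mem_ball_zero_iff] at this
    exact this.le
  have hn0 : (0 : ℝ) < (n + 1 : ℝ) := by positivity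
  have hx : ∀ x ∈ Set.Icc (n + 1 : ℝ) (n + 1 + 1), x ≠ 0 := fun x hx => (hn0.trans_le hx.1).ne'
  have hcp : ∀ x ∈ Set.Icc (n + 1 : ℝ) (n + 1 + 1), ∀ r : ℂ,
      HasDerivAt (fun y : ℝ => (y : ℂ) ^ r) (r * (x : ℂ) ^ (r - 1)) x := by
    intro x h r
    have h1 : HasDerivAt (fun y : ℂ => y ^ r) (r * (x : ℂ) ^ (r - 1) * 1) x :=
      (hasDerivAt_id (x : ℂ)).cpow_const (Or.inl (by simpa using hn0.trans_le h.1))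
    simpa using h1.comp_ofReal
  have key := norm_trapezoid_corrected_le (a := (n + 1 : ℝ))
    (M := 1320 / ((n + 1 : ℕ) : ℝ) ^ (3 / 2 : ℝ))
    (f₀ := fun x : ℝ => (x : ℂ) ^ (1 - s) / (1 - s)) (f₁ := fun x : ℝ => (x : ℂ) ^ (-s))
    (f₂ := fun x : ℝ => -s * (x : ℂ) ^ (-s - 1))
    (f₃ := fun x : ℝ => -s * ((-s - 1) * (x : ℂ) ^ (-s - 1 - 1)))
    (f₄ := fun x : ℝ => -s * ((-s - 1) * ((-s - 1 - 1) * (x : ℂ) ^ (-s - 1 - 1 - 1))))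
    (fun x h => ((hcp x h (1 - s)).div_const _).congr_deriv (by
      rw [mul_div_cancel_left₀ _ hs1]
      ring_nf))
    (fun x h => hcp x h (-s))
    (fun x h => (hcp x h (-s - 1)).const_mul _)
    (fun x h => ((hcp x h (-s - 1 - 1)).const_mul _).const_mul _)
    (fun x h => by
      have hx0 : 0 < x := hn0.trans_le h.1
      have hx1 : 1 ≤ x := le_trans (by linarith) h.1
      rw [norm_mul, norm_mul, norm_mul, Complex.norm_cpow_eq_rpow_re_of_pos hx0]
      have e1 : ‖-s‖ ≤ 10 := by rwa [norm_neg]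
      have e2 : ‖-s - 1‖ ≤ 11 := (norm_sub_le _ _).trans (by rw [norm_one]; linarith)
      have e3 : ‖-s - 1 - 1‖ ≤ 12 := (norm_sub_le _ _).trans (by rw [norm_one]; linarith)
      have e4 : x ^ (-s - 1 - 1 - 1).re ≤ 1 / ((n + 1 : ℕ) : ℝ) ^ (3 / 2 : ℝ) := by
        calc x ^ (-s - 1 - 1 - 1).re ≤ x ^ (-(3 / 2) : ℝ) := by
              refine rpow_le_rpow_of_exponent_le hx1 ?_
              simp
              linarith
          _ ≤ (n + 1 : ℝ) ^ (-(3 / 2) : ℝ) :=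
              rpow_le_rpow_of_nonpos hn0 h.1 (by norm_num)
          _ = _ := by
              rw [rpow_neg hn0.le]
              push_cast
              rw [one_div]
      calc _ ≤ 10 * (11 * (12 * (1 / ((n + 1 : ℕ) : ℝ) ^ (3 / 2 : ℝ)))) := by gcongr
        _ = _ := by ring)
  rw [← norm_neg] at key
  refine le_of_eq_of_le (congrArg norm ?_) key
  simp only [zetaApprox, Finset.sum_range_succ _ (n + 1), Complex.real_smul]
  push_cast
  ring

lemma exists_tendstoLocallyUniformlyOn_zetaApprox : ∃ g : ℂ → ℂ,
    TendstoLocallyUniformlyOn zetaApprox g atTop continuationRegion := by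
  have hsum : Summable fun n : ℕ => 1320 / ((n + 1 : ℕ) : ℝ) ^ (3 / 2 : ℝ) := by
    have h : Summable fun n : ℕ => ((n : ℝ) ^ (3 / 2 : ℝ))⁻¹ :=
      Real.summable_nat_rpow_inv.mpr (by norm_num)
    exact ((summable_nat_add_iff 1).mpr h).mul_left 1320
  have hu := tendstoUniformlyOn_tsum_nat hsum (s := continuationRegion)
    (f := fun n s => zetaApprox (n + 1) s - zetaApprox n s)
    (fun n s hs => norm_zetaApprox_succ_sub_le n hs)
  refine ⟨fun s => zetaApprox 0 s + ∑' n : ℕ, (zetaApprox (n + 1) s - zetaApprox n s),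
    TendstoUniformlyOn.tendstoLocallyUniformlyOn ?_⟩
  rw [Metric.tendstoUniformlyOn_iff] at hu ⊢
  intro ε hε
  filter_upwards [hu ε hε] with n hn s hs
  have := hn s hs
  rwa [Finset.sum_range_sub (fun n => zetaApprox n s), dist_eq_norm, ← sub_add,
    add_comm, ← add_sub_assoc, ← dist_eq_norm] at this

lemma differentiableOn_zetaApprox (n : ℕ) :
    DifferentiableOn ℂ (zetaApprox n) continuationRegion := by
  intro s hs
  have hs1 : 1 - s ≠ 0 := sub_ne_zero.mpr (ne_one_of_mem_continuationRegion hs).symm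
  have hk : ∀ k : ℕ, ((k + 1 : ℝ) : ℂ) ≠ 0 := fun k => by
    exact_mod_cast (by positivity : (k + 1 : ℝ) ≠ 0)
  unfold zetaApprox
  refine DifferentiableAt.differentiableWithinAt ?_
  have h1 : ∀ k : ℕ, DifferentiableAt ℂ (fun s : ℂ => ((k + 1 : ℝ) : ℂ) ^ (-s)) s := fun k =>
    (differentiableAt_id.neg).const_cpow (Or.inl (hk k))
  have h2 : DifferentiableAt ℂ (fun s : ℂ => ((n + 1 : ℝ) : ℂ) ^ (1 - s)) s :=
    (differentiableAt_id.const_sub 1).const_cpow (Or.inl (hk n))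
  have h3 : DifferentiableAt ℂ (fun s : ℂ => ((n + 1 : ℝ) : ℂ) ^ (-s - 1)) s :=
    (differentiableAt_id.neg.sub_const 1).const_cpow (Or.inl (hk n))
  exact (((DifferentiableAt.fun_sum fun k _ => h1 k).sub (h2.div (differentiableAt_id.const_sub 1)
    hs1)).sub ((h1 n).div_const 2)).add ((differentiableAt_id.div_const 12).mul h3)

lemma tendsto_zetaApprox_of_one_lt_re {s : ℂ} (hs : 1 < s.re) :
    Tendsto (fun n => zetaApprox n s) atTop (nhds (riemannZeta s)) := by
  have hcast : Tendsto (fun n : ℕ => (n + 1 : ℝ)) atTop atTop :=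
    tendsto_atTop_add_const_right _ _ tendsto_natCast_atTop_atTop
  have hpow : ∀ r : ℂ, r.re < 0 →
      Tendsto (fun n : ℕ => ((n + 1 : ℝ) : ℂ) ^ r) atTop (nhds 0) := by
    intro r hr
    rw [tendsto_zero_iff_norm_tendsto_zero]
    have h := (tendsto_rpow_neg_atTop (y := -r.re) (by linarith)).comp hcast
    refine h.congr fun n => ?_
    rw [Complex.norm_cpow_eq_rpow_re_of_pos (by positivity)]
    simp
  have hser : Tendsto (fun n : ℕ => ∑ k ∈ Finset.range (n + 1), ((k + 1 : ℝ) : ℂ) ^ (-s)) atTop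
      (nhds (riemannZeta s)) := by
    have h1 : Summable fun n : ℕ => 1 / ((n : ℂ) + 1) ^ s := by
      have := (summable_nat_add_iff 1).mpr (Complex.summable_one_div_nat_cpow.mpr hs)
      simpa using this
    have h2 := h1.hasSum
    rw [← zeta_eq_tsum_one_div_nat_add_one_cpow hs] at h2
    refine (h2.tendsto_sum_nat.comp (tendsto_add_atTop_nat 1)).congr fun n => ?_
    refine Finset.sum_congr rfl fun k _ => ?_
    rw [Complex.cpow_neg, one_div]
    push_cast
    rfl
  have := ((hser.sub ((hpow (1 - s) (by simp; linarith)).div_const (1 - s))).sub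
    ((hpow (-s) (by simp; linarith)).div_const 2)).add
    ((hpow (-s - 1) (by simp; linarith)).const_mul (s / 12))
  simpa [zetaApprox] using this

lemma neg_one_mem_continuationRegion : (-1 : ℂ) ∈ continuationRegion := by
  refine ⟨⟨?_, ?_⟩, ?_⟩
  · simp; norm_num
  · simp
  · simp

/-- The derivatives at `-1` of the Euler–Maclaurin approximations converge to `ζ'(-1)`. -/
lemma tendsto_deriv_zetaApprox :
    Tendsto (fun n => deriv (zetaApprox n) (-1)) atTop (nhds (deriv riemannZeta (-1))) := by
  obtain ⟨g, hg⟩ := exists_tendstoLocallyUniformlyOn_zetaApprox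
  have hd : ∀ᶠ n in atTop, DifferentiableOn ℂ (zetaApprox n) continuationRegion :=
    Eventually.of_forall differentiableOn_zetaApprox
  have hgd := hg.differentiableOn hd isOpen_continuationRegion
  have hzd : DifferentiableOn ℂ riemannZeta continuationRegion := fun s hs =>
    (differentiableAt_riemannZeta (ne_one_of_mem_continuationRegion hs)).differentiableWithinAt
  have hz0 : (2 + 3 * Complex.I) ∈ continuationRegion ∩ {s : ℂ | 1 < s.re} := by
    refine ⟨⟨⟨?_, ?_⟩, ?_⟩, ?_⟩
    · simp; norm_num
    · simp; norm_num
    · rw [mem_ball_zero_iff]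
      refine (norm_add_le _ _).trans_lt ?_
      simp
      norm_num
    · simp
  have heq : Set.EqOn g riemannZeta continuationRegion := by
    refine AnalyticOnNhd.eqOn_of_preconnected_of_eventuallyEq
      (hgd.analyticOnNhd isOpen_continuationRegion) (hzd.analyticOnNhd isOpen_continuationRegion)
      isPreconnected_continuationRegion hz0.1 ?_
    filter_upwards [(isOpen_continuationRegion.inter
      (isOpen_lt continuous_const Complex.continuous_re)).mem_nhds hz0] with s hs
    exact tendsto_nhds_unique (hg.tendsto_at hs.1) (tendsto_zetaApprox_of_one_lt_re hs.2)
  have h := (hg.deriv hd isOpen_continuationRegion).tendsto_at neg_one_mem_continuationRegion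
  rwa [(heq.eventuallyEq_of_mem (isOpen_continuationRegion.mem_nhds
    neg_one_mem_continuationRegion)).deriv_eq] at h

lemma deriv_zetaApprox_neg_one (n : ℕ) :
    deriv (zetaApprox n) (-1) = ((-(logHyperfactorial (n + 1)
      - ((((n + 1 : ℕ) : ℝ) ^ 2 / 2 + ((n + 1 : ℕ) : ℝ) / 2 + 1 / 12) * log ((n + 1 : ℕ) : ℝ)
        - ((n + 1 : ℕ) : ℝ) ^ 2 / 4)) + 1 / 12 : ℝ) : ℂ) := by
  have hk : ∀ k : ℕ, ((k + 1 : ℝ) : ℂ) ≠ 0 := fun k => by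
    exact_mod_cast (by positivity : (k + 1 : ℝ) ≠ 0)
  have h1 : ∀ k : ℕ, HasDerivAt (fun s : ℂ => ((k + 1 : ℝ) : ℂ) ^ (-s))
      (((k + 1 : ℝ) : ℂ) ^ (-(-1 : ℂ)) * Complex.log ((k + 1 : ℝ) : ℂ) * (-1)) (-1) := fun k =>
    ((hasDerivAt_id (-1 : ℂ)).neg).const_cpow (Or.inl (hk k))
  have h2 : HasDerivAt (fun s : ℂ => ((n + 1 : ℝ) : ℂ) ^ (1 - s))
      (((n + 1 : ℝ) : ℂ) ^ (1 - (-1 : ℂ)) * Complex.log ((n + 1 : ℝ) : ℂ) * (-1)) (-1) :=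
    ((hasDerivAt_id (-1 : ℂ)).const_sub 1).const_cpow (Or.inl (hk n))
  have h3 : HasDerivAt (fun s : ℂ => ((n + 1 : ℝ) : ℂ) ^ (-s - 1))
      (((n + 1 : ℝ) : ℂ) ^ (-(-1 : ℂ) - 1) * Complex.log ((n + 1 : ℝ) : ℂ) * (-1)) (-1) :=
    (((hasDerivAt_id (-1 : ℂ)).neg).sub_const 1).const_cpow (Or.inl (hk n))
  have h := (((HasDerivAt.fun_sum fun k (_ : k ∈ Finset.range (n + 1)) => h1 k).sub
    (h2.div ((hasDerivAt_id (-1 : ℂ)).const_sub 1) (by norm_num))).sub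
    ((h1 n).div_const 2)).add (((hasDerivAt_id (-1 : ℂ)).div_const 12).mul h3)
  have hlog : ∀ k : ℕ, Complex.log ((k + 1 : ℝ) : ℂ) = ((log (k + 1) : ℝ) : ℂ) := fun k =>
    (Complex.ofReal_log (by positivity)).symm
  refine h.deriv.trans ?_
  simp only [hlog, neg_neg, Complex.cpow_one, sub_self, Complex.cpow_zero, logHyperfactorial, id,
    show (1 : ℂ) - -1 = (2 : ℕ) by norm_num, Complex.cpow_natCast, mul_neg, mul_one,
    Finset.sum_neg_distrib]
  push_cast
  ring

/-- The asymptotic expansion of the hyperfactorial; its constant term is the logarithm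
`1/12 - ζ'(-1)` of the Glaisher–Kinkelin constant. -/
theorem logHyperfactorial_isBigO :
    (fun n : ℕ => logHyperfactorial n
      - ((n ^ 2 / 2 + n / 2 + 1 / 12) * log n - n ^ 2 / 4 + (1 / 12 - zetaDerivNegOne)))
      =O[atTop] fun n : ℕ => 1 / (n : ℝ) := by
  obtain ⟨L, hL⟩ := exists_logHyperfactorial_isBigO
  have hlim := hL.trans_tendsto tendsto_one_div_atTop_nhds_zero_nat
  have h1 : Tendsto (fun n => (deriv (zetaApprox n) (-1)).re) atTop (nhds (-L + 1 / 12)) := by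
    have h2 := ((hlim.comp (tendsto_add_atTop_nat 1)).neg).add_const (-L + 1 / 12)
    rw [neg_zero, zero_add] at h2
    refine h2.congr fun n => ?_
    rw [deriv_zetaApprox_neg_one, Complex.ofReal_re]
    simp only [Function.comp_apply]
    ring
  have h3 := tendsto_nhds_unique h1
    ((Complex.continuous_re.tendsto _).comp tendsto_deriv_zetaApprox)
  have h4 : 1 / 12 - zetaDerivNegOne = L := by
    rw [zetaDerivNegOne, ← h3]
    ring
  rw [h4]
  exact hL

/-! ### The Barnes function -/

lemma abs_log_one_add_sub_le {y : ℝ} (hy : |y| ≤ 1 / 2) :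
    |log (1 + y) - (y - y ^ 2 / 2)| ≤ 2 * |y| ^ 3 := by
  have hlog := Real.abs_log_sub_add_sum_range_le (x := -y) (by rw [abs_neg]; linarith) 2
  rw [abs_neg, sub_neg_eq_add] at hlog
  simp only [Finset.sum_range_succ, Finset.sum_range_zero] at hlog
  norm_num at hlog
  have e1 : log (1 + y) - (y - y ^ 2 / 2) = -y + y ^ 2 / 2 + log (1 + y) := by ring
  rw [e1]
  refine hlog.trans ?_
  rw [div_le_iff₀ (by linarith)]
  nlinarith [pow_nonneg (abs_nonneg y) 3]

/-- The logarithm of the `k`-th factor in the Weierstrass product of `G(1 + z)`, with `k` counted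
from zero. -/
def barnesLogTerm (z : ℝ) (k : ℕ) : ℝ :=
  ((k : ℝ) + 1) * log (1 + z / ((k : ℝ) + 1)) + z ^ 2 / (2 * ((k : ℝ) + 1)) - z

lemma summable_barnesLogTerm (z : ℝ) : Summable (barnesLogTerm z) := by
  have hs : Summable fun k : ℕ => 2 * |z| ^ 3 * (1 / ((k : ℝ) + 1) ^ 2) := by
    have h := (summable_nat_add_iff 1).mpr (Real.summable_one_div_nat_pow.mpr one_lt_two)
    simp only [Nat.cast_add, Nat.cast_one] at h
    exact h.mul_left _
  refine Summable.of_norm_bounded_eventually_nat hs ?_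
  filter_upwards [eventually_ge_atTop ⌈2 * |z|⌉₊] with k hk
  have hk' : 2 * |z| ≤ k := (Nat.le_ceil _).trans (by exact_mod_cast hk)
  have hk0 : (0 : ℝ) < (k : ℝ) + 1 := by positivity
  set y : ℝ := z / ((k : ℝ) + 1) with hy
  have hyz : z = y * ((k : ℝ) + 1) := by rw [hy]; field_simp
  have hyabs : |y| = |z| / ((k : ℝ) + 1) := by rw [hy, abs_div, abs_of_pos hk0]
  have hy2 : |y| ≤ 1 / 2 := by
    rw [hyabs, div_le_iff₀ hk0]
    linarith
  have hterm : barnesLogTerm z k = ((k : ℝ) + 1) * (log (1 + y) - (y - y ^ 2 / 2)) := by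
    rw [barnesLogTerm, ← hy, hyz]
    field_simp
    ring
  rw [hterm, norm_mul, Real.norm_of_nonneg hk0.le, Real.norm_eq_abs]
  calc ((k : ℝ) + 1) * |log (1 + y) - (y - y ^ 2 / 2)|
      ≤ ((k : ℝ) + 1) * (2 * |y| ^ 3) := by
        gcongr
        exact abs_log_one_add_sub_le hy2
    _ = 2 * |z| ^ 3 * (1 / ((k : ℝ) + 1) ^ 2) := by
      rw [hyabs]
      field_simp

/-- For `x ≥ 1` the Weierstrass product converges, so that `G(x)` is the exponential of the sum of
the logarithms of its factors. -/
lemma barnesG_eq_exp {x : ℝ} (hx : 1 ≤ x) :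
    barnesG x = exp ((x - 1) / 2 * log (2 * π)
      - ((x - 1) + (1 + eulerMascheroniConstant) * (x - 1) ^ 2) / 2
      + ∑' k, barnesLogTerm (x - 1) k) := by
  have hz : 0 ≤ x - 1 := by linarith
  have hterm : ∀ k : ℕ, (1 + (x - 1) / ((k : ℝ) + 1)) ^ (k + 1) *
      exp ((x - 1) ^ 2 / (2 * ((k : ℝ) + 1)) - (x - 1)) = (exp ∘ barnesLogTerm (x - 1)) k := by
    intro k
    have : 0 < 1 + (x - 1) / ((k : ℝ) + 1) := by positivity
    rw [Function.comp_apply, barnesLogTerm, add_sub_assoc, exp_add,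
      show ((k : ℝ) + 1) = ((k + 1 : ℕ) : ℝ) by push_cast; ring, exp_nat_mul, exp_log]
    simpa using this
  rw [barnesG, tprod_congr hterm, (summable_barnesLogTerm (x - 1)).hasSum.rexp.tprod_eq,
    exp_add, sub_eq_add_neg _ (_ / 2), exp_add, rpow_def_of_pos (by positivity)]
  ring_nf

lemma barnesG_pos {x : ℝ} (hx : 1 ≤ x) : 0 < barnesG x := by
  rw [barnesG_eq_exp hx]
  exact exp_pos _

lemma tendsto_log_barnesG {x : ℝ} (hx : 1 ≤ x) :
    Tendsto (fun K : ℕ => (x - 1) / 2 * log (2 * π)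
      - ((x - 1) + (1 + eulerMascheroniConstant) * (x - 1) ^ 2) / 2
      + ∑ k ∈ Finset.range K, barnesLogTerm (x - 1) k) atTop (nhds (log (barnesG x))) := by
  rw [barnesG_eq_exp hx, log_exp]
  exact (summable_barnesLogTerm (x - 1)).hasSum.tendsto_sum_nat.const_add _

lemma barnesG_one : barnesG 1 = 1 := by
  simp [barnesG]

lemma tendsto_log_factorial :
    Tendsto (fun n : ℕ => log n.factorial - ((n + 1 / 2) * log n - n + log (2 * π) / 2))
      atTop (nhds 0) := by
  have h0 : Tendsto (fun n : ℕ => 1 / (n : ℝ) ^ 2) atTop (nhds 0) := by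
    simpa using (tendsto_one_div_atTop_nhds_zero_nat (𝕜 := ℝ)).pow 2
  have h := (log_factorial_isBigO.trans_tendsto h0).add
    ((tendsto_one_div_atTop_nhds_zero_nat (𝕜 := ℝ)).const_mul (1 / 12))
  rw [mul_zero, add_zero] at h
  refine h.congr fun n => ?_
  have : 1 / (12 * (n : ℝ)) = 1 / 12 * (1 / n) := by rw [one_div_mul_one_div]
  rw [this]
  ring

lemma tendsto_logHyperfactorial :
    Tendsto (fun n : ℕ => logHyperfactorial n
      - ((n ^ 2 / 2 + n / 2 + 1 / 12) * log n - n ^ 2 / 4 + (1 / 12 - zetaDerivNegOne)))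
      atTop (nhds 0) :=
  logHyperfactorial_isBigO.trans_tendsto tendsto_one_div_atTop_nhds_zero_nat

/-- Summation by parts, which turns the quotient of partial products at `z + 1` and `z` into the
finite product in Euler's limit for `Γ(z + 1)`. -/
lemma sum_barnesLogTerm_add_one_sub {z : ℝ} (hz : 0 ≤ z) (K : ℕ) :
    ∑ k ∈ Finset.range K, barnesLogTerm (z + 1) k - ∑ k ∈ Finset.range K, barnesLogTerm z k
      = (K + 1) * log (z + 1 + K) - ∑ j ∈ Finset.range (K + 1), log (z + 1 + j)
        + (2 * z + 1) / 2 * (harmonic K : ℝ) - K := by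
  induction K with
  | zero => simp
  | succ K ih =>
    have hK : (0 : ℝ) < (K : ℝ) + 1 := by positivity
    have e1 : log (1 + (z + 1) / ((K : ℝ) + 1)) = log (z + 1 + (K + 1)) - log (K + 1) := by
      rw [← log_div (by positivity) hK.ne']
      congr 1
      field_simp
      ring
    have e2 : log (1 + z / ((K : ℝ) + 1)) = log (z + 1 + K) - log (K + 1) := by
      rw [← log_div (by positivity) hK.ne']
      congr 1
      field_simp
      ring
    rw [Finset.sum_range_succ, Finset.sum_range_succ, Finset.sum_range_succ (n := K + 1),
      harmonic_succ, barnesLogTerm, barnesLogTerm, e1, e2]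
    push_cast
    have : (z + 1) ^ 2 / (2 * ((K : ℝ) + 1)) - z ^ 2 / (2 * ((K : ℝ) + 1))
        = (2 * z + 1) / 2 * ((K : ℝ) + 1)⁻¹ := by
      field_simp
      ring
    linear_combination ih + this

lemma tendsto_nat_mul_log_one_add_div (t : ℝ) :
    Tendsto (fun K : ℕ => (K : ℝ) * log (1 + t / K)) atTop (nhds t) :=
  (tendsto_mul_log_one_add_div_atTop t).comp tendsto_natCast_atTop_atTop

lemma tendsto_log_one_add_div (t : ℝ) :
    Tendsto (fun K : ℕ => log (1 + t / (K : ℝ))) atTop (nhds 0) := by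
  have h : Tendsto (fun K : ℕ => 1 + t / (K : ℝ)) atTop (nhds (1 + 0)) :=
    (tendsto_const_div_atTop_nhds_zero_nat t).const_add 1
  simpa using h.log (by norm_num)

/-- The functional equation `G(x + 1) = Γ(x) G(x)` of the Barnes function. -/
theorem log_barnesG_add_one {x : ℝ} (hx : 1 ≤ x) :
    log (barnesG (x + 1)) = log (Gamma x) + log (barnesG x) := by
  have hz : 0 ≤ x - 1 := by linarith
  have h1 := (tendsto_log_barnesG (x := x + 1) (by linarith)).sub (tendsto_log_barnesG hx)
  have h2 := ((((tendsto_nat_mul_log_one_add_div x).add (tendsto_log_one_add_div x)).add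
    (BohrMollerup.tendsto_log_gamma (x := x) (by linarith))).sub tendsto_log_factorial).add
    (tendsto_harmonic_sub_log.const_mul (x - 1 / 2))
  have h3 := h2.add_const (-1 / 2 + (1 - 2 * x) * (1 + eulerMascheroniConstant) / 2)
  have h4 := tendsto_nhds_unique (h1.congr' ?_) h3
  · linear_combination h4
  · filter_upwards [eventually_ne_atTop 0] with K hK
    have hK0 : (0 : ℝ) < K := by exact_mod_cast Nat.pos_of_ne_zero hK
    have hsum := sum_barnesLogTerm_add_one_sub hz K
    rw [show x - 1 + 1 = x by ring] at hsum
    have e1 : log (1 + x / (K : ℝ)) = log (x + K) - log K := by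
      rw [← log_div (by positivity) hK0.ne']
      congr 1
      field_simp
      ring
    rw [show x + 1 - 1 = x by ring, e1, BohrMollerup.logGammaSeq]
    linear_combination hsum

lemma log_barnesG_natCast_add {x : ℝ} (hx : 1 ≤ x) (c : ℕ) :
    log (barnesG (c + x)) = log (barnesG x) + ∑ j ∈ Finset.range c, log (Gamma (j + x)) := by
  induction c with
  | zero => simp
  | succ c ih =>
    rw [Finset.sum_range_succ, ← add_assoc, ← ih, add_comm (log (barnesG (c + x))),
      ← log_barnesG_add_one (by linarith [(Nat.cast_nonneg c : (0 : ℝ) ≤ c)])]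
    push_cast
    ring_nf

/-- At `z = 1/2` the factors are powers of `(2k+1)/(2k)`, and splitting the integers up to `2K` by
parity evaluates the partial products. -/
lemma sum_barnesLogTerm_half (K : ℕ) :
    ∑ k ∈ Finset.range K, barnesLogTerm (1 / 2) k
      = logHyperfactorial (2 * K) / 2 - log (2 * K).factorial / 2 + K * log (2 * K + 1)
        - 2 * logHyperfactorial K + log K.factorial / 2 - K ^ 2 * log 2 - K * log 2 / 2
        + (harmonic K : ℝ) / 8 - K / 2 := by
  induction K with
  | zero => simp [logHyperfactorial]
  | succ K ih =>
    have hK : (0 : ℝ) < (K : ℝ) + 1 := by positivity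
    have e1 : log (1 + 1 / 2 / ((K : ℝ) + 1)) = log (2 * K + 3) - log 2 - log (K + 1) := by
      rw [← log_div (by positivity) two_ne_zero, ← log_div (by positivity) hK.ne']
      congr 1
      field_simp
      ring
    have e2 : log (2 * (K : ℝ) + 2) = log 2 + log (K + 1) := by
      rw [← log_mul two_ne_zero hK.ne']
      congr 1
      ring
    have e3 : log ((2 * (K + 1)).factorial : ℝ)
        = log (2 * K + 2) + log (2 * K + 1) + log ((2 * K).factorial : ℝ) := by
      rw [show 2 * (K + 1) = 2 * K + 1 + 1 by ring, Nat.factorial_succ, Nat.factorial_succ]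
      push_cast
      rw [log_mul (by positivity) (by positivity), log_mul (by positivity) (by positivity)]
      ring_nf
    have e4 : log ((K + 1).factorial : ℝ) = log (K + 1) + log (K.factorial : ℝ) := by
      rw [Nat.factorial_succ]
      push_cast
      rw [log_mul (by positivity) (by positivity)]
    have e5 : logHyperfactorial (2 * (K + 1)) = logHyperfactorial (2 * K)
        + (2 * K + 1) * log (2 * K + 1) + (2 * K + 2) * log (2 * K + 2) := by
      rw [show 2 * (K + 1) = 2 * K + 1 + 1 by ring, logHyperfactorial, Finset.sum_range_succ,
        Finset.sum_range_succ, ← logHyperfactorial]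
      push_cast
      ring_nf
    have e6 : logHyperfactorial (K + 1) = logHyperfactorial K + (K + 1) * log (K + 1) := by
      rw [logHyperfactorial, Finset.sum_range_succ, ← logHyperfactorial]
    rw [Finset.sum_range_succ, ih, harmonic_succ, barnesLogTerm, e1, e3, e4, e5, e6, e2]
    push_cast
    rw [show 2 * ((K : ℝ) + 1) + 1 = 2 * K + 3 by ring]
    have : (1 / 2 : ℝ) ^ 2 / (2 * ((K : ℝ) + 1)) = ((K : ℝ) + 1)⁻¹ / 8 := by
      field_simp
      norm_num
    linear_combination this

/-- The value of the Barnes function at `3/2`. -/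
theorem log_barnesG_three_halves :
    log (barnesG (3 / 2)) = log π / 4 + log 2 / 24 + 3 / 2 * zetaDerivNegOne := by
  have h1 := tendsto_log_barnesG (x := 3 / 2) (by norm_num)
  have hdouble : Tendsto (fun K : ℕ => 2 * K) atTop atTop :=
    tendsto_id.const_mul_atTop' two_pos
  have h2 := ((((((tendsto_logHyperfactorial.comp hdouble).div_const 2).sub
    ((tendsto_log_factorial.comp hdouble).div_const 2)).sub
    (tendsto_logHyperfactorial.const_mul 2)).add (tendsto_log_factorial.div_const 2)).add
    ((tendsto_nat_mul_log_one_add_div (1 / 2)))).add (tendsto_harmonic_sub_log.div_const 8)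
  have h3 := h2.add_const (log (2 * π) / 4 - (1 / 2 + (1 + eulerMascheroniConstant) / 4) / 2
    - 5 / 24 * log 2 - 3 / 2 * (1 / 12 - zetaDerivNegOne))
  have h4 := tendsto_nhds_unique (h1.congr' ?_) h3
  · rw [h4, log_mul two_ne_zero pi_ne_zero]
    ring
  · filter_upwards [eventually_ne_atTop 0] with K hK
    have hK0 : (0 : ℝ) < K := by exact_mod_cast Nat.pos_of_ne_zero hK
    have e1 : log (1 + 1 / 2 / (K : ℝ)) = log (2 * K + 1) - log 2 - log K := by
      rw [← log_div (by positivity) two_ne_zero, ← log_div (by positivity) hK0.ne']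
      congr 1
      field_simp
    rw [show (3 / 2 : ℝ) - 1 = 1 / 2 by norm_num, sum_barnesLogTerm_half, e1]
    simp only [Function.comp_apply]
    push_cast
    rw [log_mul two_ne_zero hK0.ne']
    ring

/-! ### Superfactorials with shifted argument -/

lemma isBigO_natCast_add (a : ℝ) :
    (fun n : ℕ => (n : ℝ) + a) =O[atTop] fun n : ℕ => (n : ℝ) := by
  refine (isBigO_refl _ _).add (IsBigO.of_bound |a| ?_)
  filter_upwards [eventually_ge_atTop 1] with n hn
  rw [Real.norm_eq_abs, Real.norm_of_nonneg (Nat.cast_nonneg n)]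
  exact le_mul_of_one_le_right (abs_nonneg a) (by exact_mod_cast hn)

lemma isBigO_one_div_natCast_add (s : ℕ) :
    (fun n : ℕ => 1 / ((n : ℝ) + s)) =O[atTop] fun n : ℕ => 1 / (n : ℝ) := by
  refine IsBigO.of_bound 1 ?_
  filter_upwards [eventually_ge_atTop 1] with n hn
  have : (0 : ℝ) < n := by exact_mod_cast hn
  rw [Real.norm_of_nonneg (by positivity), Real.norm_of_nonneg (by positivity), one_mul]
  gcongr
  simp

lemma isBigO_const_mul_one_div (a : ℝ) :
    (fun n : ℕ => a * (1 / (n : ℝ))) =O[atTop] fun n : ℕ => 1 / (n : ℝ) :=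
  (isBigO_refl _ _).const_mul_left a

lemma log_natCast_add_isBigO (s : ℕ) :
    (fun n : ℕ => log ((n : ℝ) + s) - (log n + s / n - s ^ 2 / (2 * n ^ 2)))
      =O[atTop] fun n : ℕ => (1 / (n : ℝ)) ^ 3 := by
  refine IsBigO.of_bound (2 * s ^ 3) ?_
  filter_upwards [eventually_ge_atTop (2 * s), eventually_ne_atTop 0] with n hn hn0
  have hn1 : (0 : ℝ) < n := by exact_mod_cast Nat.pos_of_ne_zero hn0
  have hn2 : (2 * s : ℝ) ≤ n := by exact_mod_cast hn
  have habs : |(s : ℝ) / n| = s / n := abs_of_nonneg (by positivity)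
  have h := abs_log_one_add_sub_le (y := (s : ℝ) / n) (by
    rw [habs, div_le_iff₀ hn1]
    linarith)
  have e1 : log (1 + (s : ℝ) / n) = log (n + s) - log n := by
    rw [← log_div (by positivity) hn1.ne']
    congr 1
    field_simp
  rw [e1, habs] at h
  rw [Real.norm_eq_abs, Real.norm_of_nonneg (by positivity)]
  calc |log ((n : ℝ) + s) - (log n + s / n - s ^ 2 / (2 * n ^ 2))|
      = |log ((n : ℝ) + s) - log n - (s / n - (s / n) ^ 2 / 2)| := by
        congr 1
        ring
    _ ≤ 2 * ((s : ℝ) / n) ^ 3 := h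
    _ = 2 * s ^ 3 * (1 / (n : ℝ)) ^ 3 := by ring

/-- Stirling's formula re-expanded in powers of `n` at the shifted argument `n + s`. -/
lemma log_factorial_add_isBigO (s : ℕ) :
    (fun n : ℕ => log (n + s).factorial
      - ((n + s + 1 / 2) * log n - n + log (2 * π) / 2
        + ((s : ℝ) ^ 2 / 2 + s / 2 + 1 / 12) * (1 / n)))
      =O[atTop] fun n : ℕ => (1 / (n : ℝ)) ^ 2 := by
  have h1 : (fun n : ℕ => log (n + s).factorial - ((((n + s : ℕ) : ℝ) + 1 / 2)
      * log ((n + s : ℕ) : ℝ) - ((n + s : ℕ) : ℝ) + log (2 * π) / 2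
      + 1 / (12 * ((n + s : ℕ) : ℝ)))) =O[atTop] fun n : ℕ => (1 / (n : ℝ)) ^ 2 := by
    refine (log_factorial_isBigO.comp_tendsto (tendsto_add_atTop_nat s)).trans ?_
    refine ((isBigO_one_div_natCast_add s).pow 2).congr_left fun n => ?_
    simp only [Function.comp_apply]
    push_cast
    rw [one_div_pow]
  have h2 : (fun n : ℕ => ((n : ℝ) + (s + 1 / 2)) * (log ((n : ℝ) + s)
      - (log n + s / n - s ^ 2 / (2 * n ^ 2)))) =O[atTop] fun n : ℕ => (1 / (n : ℝ)) ^ 2 := by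
    refine ((isBigO_natCast_add _).mul (log_natCast_add_isBigO s)).congr' EventuallyEq.rfl ?_
    filter_upwards [eventually_ne_atTop 0] with n hn
    have : (n : ℝ) ≠ 0 := by exact_mod_cast hn
    field_simp
  have h3 : (fun n : ℕ => -(((s : ℝ) + 1 / 2) * s ^ 2 / 2) * (1 / (n : ℝ)) ^ 2
      - s / 12 * (1 / (n : ℝ) * (1 / ((n : ℝ) + s))))
      =O[atTop] fun n : ℕ => (1 / (n : ℝ)) ^ 2 := by
    refine ((isBigO_refl _ _).const_mul_left _).sub (IsBigO.const_mul_left ?_ _)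
    simpa only [pow_two] using (isBigO_refl (fun n : ℕ => 1 / (n : ℝ)) atTop).mul
      (isBigO_one_div_natCast_add s)
  refine ((h1.add h2).add h3).congr' ?_ EventuallyEq.rfl
  filter_upwards [eventually_ne_atTop 0] with n hn
  have hn1 : (0 : ℝ) < n := by exact_mod_cast Nat.pos_of_ne_zero hn
  have hn2 : (n : ℝ) + s ≠ 0 := by positivity
  push_cast
  field_simp
  ring

/-- The logarithm `∑_{j < n} log j!` of the superfactorial. -/
def logSuperfactorial (n : ℕ) : ℝ := ∑ j ∈ Finset.range n, log (j.factorial : ℝ)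

lemma logSuperfactorial_eq (n : ℕ) :
    logSuperfactorial n = n * log n.factorial - logHyperfactorial n := by
  induction n with
  | zero => simp [logSuperfactorial, logHyperfactorial]
  | succ n ih =>
    rw [logSuperfactorial, Finset.sum_range_succ, ← logSuperfactorial, ih, logHyperfactorial,
      logHyperfactorial, Finset.sum_range_succ, Nat.factorial_succ]
    push_cast
    rw [log_mul (by positivity) (by positivity)]
    ring

/-- The expansion of `log G(n + s + 1)` at integers. -/
lemma logSuperfactorial_add_isBigO (s : ℕ) :
    (fun n : ℕ => logSuperfactorial (n + s)
      - (((n : ℝ) ^ 2 / 2 + s * n + (s ^ 2 / 2 - 1 / 12)) * log n - 3 / 4 * (n : ℝ) ^ 2 - s * n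
        + (n + s) * (log (2 * π) / 2) + zetaDerivNegOne))
      =O[atTop] fun n : ℕ => 1 / (n : ℝ) := by
  have h1 : (fun n : ℕ => ((n : ℝ) + s) * (log (n + s).factorial - ((((n + s : ℕ) : ℝ) + 1 / 2)
      * log ((n + s : ℕ) : ℝ) - ((n + s : ℕ) : ℝ) + log (2 * π) / 2
      + 1 / (12 * ((n + s : ℕ) : ℝ))))) =O[atTop] fun n : ℕ => 1 / (n : ℝ) := by
    refine ((isBigO_refl (fun n : ℕ => (n : ℝ) + s) atTop).mul
      (log_factorial_isBigO.comp_tendsto (tendsto_add_atTop_nat s))).trans ?_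
    refine (isBigO_one_div_natCast_add s).congr' ?_ EventuallyEq.rfl
    filter_upwards [eventually_ne_atTop 0] with n hn
    have hn1 : (0 : ℝ) < n := by exact_mod_cast Nat.pos_of_ne_zero hn
    simp only [Function.comp_apply]
    push_cast
    field_simp
  have h2 : (fun n : ℕ => logHyperfactorial (n + s)
      - (((((n + s : ℕ) : ℝ)) ^ 2 / 2 + ((n + s : ℕ) : ℝ) / 2 + 1 / 12) * log ((n + s : ℕ) : ℝ)
        - ((n + s : ℕ) : ℝ) ^ 2 / 4 + (1 / 12 - zetaDerivNegOne)))
      =O[atTop] fun n : ℕ => 1 / (n : ℝ) := by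
    refine (logHyperfactorial_isBigO.comp_tendsto (tendsto_add_atTop_nat s)).trans ?_
    refine (isBigO_one_div_natCast_add s).congr_left fun n => ?_
    simp only [Function.comp_apply]
    push_cast
    rfl
  have h3 : (fun n : ℕ => (1 / 2 * (((n : ℝ) + s) * ((n : ℝ) + s)) - 1 / 12)
      * (log ((n : ℝ) + s) - (log n + s / n - s ^ 2 / (2 * n ^ 2))))
      =O[atTop] fun n : ℕ => 1 / (n : ℝ) := by
    have hq : (fun n : ℕ => 1 / 2 * (((n : ℝ) + s) * ((n : ℝ) + s)) - 1 / 12)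
        =O[atTop] fun n : ℕ => (n : ℝ) * n := by
      refine (((isBigO_natCast_add _).mul (isBigO_natCast_add _)).const_mul_left _).sub
        (IsBigO.of_bound 1 ?_)
      filter_upwards [eventually_ge_atTop 1] with n hn
      have : (1 : ℝ) ≤ n := by exact_mod_cast hn
      rw [Real.norm_of_nonneg (by positivity), Real.norm_of_nonneg (by positivity)]
      nlinarith
    refine (hq.mul (log_natCast_add_isBigO s)).congr' EventuallyEq.rfl ?_
    filter_upwards [eventually_ne_atTop 0] with n hn
    have : (n : ℝ) ≠ 0 := by exact_mod_cast hn
    field_simp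
  have h4 : (fun n : ℕ => (-(s : ℝ) ^ 3 / 2 + (s ^ 2 / 2 - 1 / 12) * s) * (1 / (n : ℝ))
      - ((s : ℝ) ^ 2 / 2 - 1 / 12) * s ^ 2 / 2 * (1 / (n : ℝ)) ^ 2)
      =O[atTop] fun n : ℕ => 1 / (n : ℝ) := by
    refine (isBigO_const_mul_one_div _).sub (IsBigO.const_mul_left ?_ _)
    refine IsBigO.of_bound 1 ?_
    filter_upwards [eventually_ge_atTop 1] with n hn
    have hn1 : (1 : ℝ) ≤ n := by exact_mod_cast hn
    have h0 : (0 : ℝ) ≤ 1 / n := by positivity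
    have h1 : 1 / (n : ℝ) ≤ 1 := by
      rw [div_le_one (by linarith)]
      exact hn1
    rw [Real.norm_of_nonneg (by positivity), Real.norm_of_nonneg h0]
    nlinarith
  refine (((h1.sub h2).add h3).add h4).congr' ?_ EventuallyEq.rfl
  filter_upwards [eventually_ne_atTop 0] with n hn
  have hn1 : (0 : ℝ) < n := by exact_mod_cast Nat.pos_of_ne_zero hn
  have hn2 : (n : ℝ) + s ≠ 0 := by positivity
  rw [logSuperfactorial_eq]
  push_cast
  field_simp
  ring

lemma logSuperfactorial_eq_log_barnesG (c : ℕ) :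
    logSuperfactorial c = log (barnesG (c + 1)) := by
  rw [log_barnesG_natCast_add le_rfl, barnesG_one, log_one, zero_add]
  exact Finset.sum_congr rfl fun j _ => by rw [Gamma_nat_eq_factorial]

lemma sum_fin_eq_sub {f : ℕ → ℝ} (n c : ℕ) :
    ∑ k : Fin n, f (k + c) = ∑ j ∈ Finset.range (n + c), f j - ∑ j ∈ Finset.range c, f j := by
  rw [Fin.sum_univ_eq_sum_range (fun k => f (k + c)), add_comm n c, Finset.sum_range_add,
    add_sub_cancel_left]
  exact Finset.sum_congr rfl fun k _ => by rw [add_comm]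

lemma sum_fin_rev_eq_sub {f : ℕ → ℝ} (n c : ℕ) :
    ∑ k : Fin n, f (n - 1 - k + c)
      = ∑ j ∈ Finset.range (n + c), f j - ∑ j ∈ Finset.range c, f j := by
  rw [← sum_fin_eq_sub, Fin.sum_univ_eq_sum_range (fun k => f (k + c)),
    Fin.sum_univ_eq_sum_range (fun k => f (n - 1 - k + c)),
    Finset.sum_range_reflect (fun k => f (k + c))]

lemma log_ZC {n : ℕ} (hn : n ≠ 0) (α c : ℕ) :
    log (ZC α c n) = log n.factorial + (logSuperfactorial (n + c) - logSuperfactorial c)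
      + (logSuperfactorial (n + α) - logSuperfactorial α) - n * log (n + (α + c)).factorial := by
  have hne : ∀ m : ℕ, (m.factorial : ℝ) ≠ 0 := fun m => by positivity
  rw [ZC_eq hn, log_mul (hne _) (Finset.prod_ne_zero_iff.mpr fun k _ =>
    div_ne_zero (mul_ne_zero (hne _) (hne _)) (hne _)), log_prod fun k _ =>
    div_ne_zero (mul_ne_zero (hne _) (hne _)) (hne _)]
  have hterm : ∀ k : Fin n, log (((k + c).factorial
      * (n + α + c + 1 - (k + c + 2)).factorial : ℝ) / (n + α + c).factorial)
      = log ((k + c).factorial : ℝ) + log ((n - 1 - k + α).factorial : ℝ)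
        - log ((n + (α + c)).factorial : ℝ) := by
    intro k
    rw [log_div (mul_ne_zero (hne _) (hne _)) (hne _), log_mul (hne _) (hne _),
      show n + α + c + 1 - (k + c + 2) = n - 1 - k + α by omega, add_assoc n α c]
  rw [Finset.sum_congr rfl fun k _ => hterm k, Finset.sum_sub_distrib, Finset.sum_add_distrib,
    sum_fin_eq_sub (f := fun j => log (j.factorial : ℝ)),
    sum_fin_rev_eq_sub (f := fun j => log (j.factorial : ℝ)), Finset.sum_const, Finset.card_univ,
    Fintype.card_fin, nsmul_eq_mul]
  simp only [logSuperfactorial]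
  ring

/-- The logarithm `∑_{m < n} log (2 m + 1)!`. -/
def logOddSuperfactorial (n : ℕ) : ℝ := ∑ m ∈ Finset.range n, log ((2 * m + 1).factorial : ℝ)

/-- Pairing `(2m)!` with `(2m+1)! = (2m+1) (2m)!` reduces the product of odd factorials to the
superfactorial. -/
lemma logOddSuperfactorial_eq (n : ℕ) :
    logOddSuperfactorial n = (logSuperfactorial (2 * n) + log (2 * n).factorial - n * log 2
      - log n.factorial) / 2 := by
  induction n with
  | zero => simp [logOddSuperfactorial, logSuperfactorial]
  | succ n ih =>
    have hn : (0 : ℝ) < (n : ℝ) + 1 := by positivity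
    have e1 : log ((2 * n + 1).factorial : ℝ) = log (2 * n + 1) + log ((2 * n).factorial : ℝ) := by
      rw [Nat.factorial_succ]
      push_cast
      rw [log_mul (by positivity) (by positivity)]
    have e2 : log ((2 * n + 1 + 1).factorial : ℝ)
        = log 2 + log (n + 1) + log ((2 * n + 1).factorial : ℝ) := by
      rw [Nat.factorial_succ, ← log_mul two_ne_zero hn.ne']
      push_cast
      rw [log_mul (by positivity) (by positivity)]
      ring_nf
    have e3 : log ((n + 1).factorial : ℝ) = log (n + 1) + log (n.factorial : ℝ) := by
      rw [Nat.factorial_succ]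
      push_cast
      rw [log_mul (by positivity) (by positivity)]
    rw [logOddSuperfactorial, Finset.sum_range_succ, ← logOddSuperfactorial, ih,
      show 2 * (n + 1) = 2 * n + 1 + 1 by ring, logSuperfactorial, logSuperfactorial,
      Finset.sum_range_succ, Finset.sum_range_succ, e2, e3, e1]
    push_cast
    ring

/-- By the duplication formula the odd factorials `Γ(2 (m + 1))` telescope through the functional
equation of `G` at integers and half-integers. -/
lemma logOddSuperfactorial_eq_log_barnesG (c : ℕ) :
    logOddSuperfactorial c = c ^ 2 * log 2 - c / 2 * log π + log (barnesG (c + 1))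
      + log (barnesG (c + 3 / 2)) - log (barnesG (3 / 2)) := by
  have hdup : ∀ m : ℕ, log ((2 * m + 1).factorial : ℝ) = (2 * m + 1) * log 2 - log π / 2
      + log (m.factorial : ℝ) + log (Gamma (m + 3 / 2)) := by
    intro m
    have h := Gamma_mul_Gamma_add_half ((m : ℝ) + 1)
    rw [Gamma_nat_eq_factorial, show (m : ℝ) + 1 + 1 / 2 = m + 3 / 2 by ring,
      show 2 * ((m : ℝ) + 1) = ((2 * m + 1 : ℕ) : ℝ) + 1 by push_cast; ring,
      Gamma_nat_eq_factorial] at h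
    have h1 : 0 < Gamma ((m : ℝ) + 3 / 2) := Gamma_pos_of_pos (by positivity)
    have h2 := congrArg log h
    rw [log_mul (by positivity) h1.ne', log_mul (by positivity) (by positivity),
      log_mul (by positivity) (by positivity), log_rpow two_pos, log_sqrt pi_pos.le] at h2
    push_cast at h2
    linear_combination -h2
  rw [← logSuperfactorial_eq_log_barnesG, log_barnesG_natCast_add (by norm_num)]
  induction c with
  | zero => simp [logOddSuperfactorial, logSuperfactorial]
  | succ c ih =>
    rw [logOddSuperfactorial, Finset.sum_range_succ, ← logOddSuperfactorial, ih, hdup,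
      logSuperfactorial, logSuperfactorial, Finset.sum_range_succ, Finset.sum_range_succ]
    push_cast
    ring

lemma log_ZH {n : ℕ} (hn : n ≠ 0) (α c : ℕ) :
    log (ZH α c n) = log n.factorial + n * log 2
      + (logOddSuperfactorial (n + c) - logOddSuperfactorial c)
      + (logOddSuperfactorial (n + α) - logOddSuperfactorial α)
      - n * log (2 * n + (2 * (α + c) + 1)).factorial := by
  have hne : ∀ m : ℕ, (m.factorial : ℝ) ≠ 0 := fun m => by positivity
  rw [ZH_eq hn, log_mul (mul_ne_zero (hne _) (by positivity)) (Finset.prod_ne_zero_iff.mpr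
    fun k _ => div_ne_zero (mul_ne_zero (hne _) (hne _)) (hne _)), log_mul (hne _) (by positivity),
    log_pow, log_prod fun k _ => div_ne_zero (mul_ne_zero (hne _) (hne _)) (hne _)]
  have hterm : ∀ k : Fin n, log (((2 * (k + c) + 1).factorial
      * (2 * (n + α + c + 1) - (2 * (k + c) + 3)).factorial : ℝ)
        / (2 * (n + α + c) + 1).factorial)
      = log ((2 * (k + c) + 1).factorial : ℝ) + log ((2 * (n - 1 - k + α) + 1).factorial : ℝ)
        - log ((2 * n + (2 * (α + c) + 1)).factorial : ℝ) := by
    intro k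
    rw [log_div (mul_ne_zero (hne _) (hne _)) (hne _), log_mul (hne _) (hne _),
      show 2 * (n + α + c + 1) - (2 * (k + c) + 3) = 2 * (n - 1 - k + α) + 1 by omega,
      show 2 * (n + α + c) + 1 = 2 * n + (2 * (α + c) + 1) by ring]
  rw [Finset.sum_congr rfl fun k _ => hterm k, Finset.sum_sub_distrib, Finset.sum_add_distrib,
    sum_fin_eq_sub (f := fun j => log ((2 * j + 1).factorial : ℝ)),
    sum_fin_rev_eq_sub (f := fun j => log ((2 * j + 1).factorial : ℝ)), Finset.sum_const,
    Finset.card_univ, Fintype.card_fin, nsmul_eq_mul]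
  simp only [logOddSuperfactorial]
  ring

/-! ### Expansions at even arguments -/

lemma isBigO_natCast_mul {f : ℕ → ℝ} (h : f =O[atTop] fun n : ℕ => (1 / (n : ℝ)) ^ 2) :
    (fun n : ℕ => (n : ℝ) * f n) =O[atTop] fun n : ℕ => 1 / (n : ℝ) := by
  refine ((isBigO_refl (fun n : ℕ => (n : ℝ)) atTop).mul h).congr' EventuallyEq.rfl ?_
  filter_upwards [eventually_ne_atTop 0] with n hn
  have : (n : ℝ) ≠ 0 := by exact_mod_cast hn
  field_simp

lemma isBigO_one_div_sq :
    (fun n : ℕ => (1 / (n : ℝ)) ^ 2) =O[atTop] fun n : ℕ => 1 / (n : ℝ) := by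
  refine IsBigO.of_bound 1 ?_
  filter_upwards [eventually_ge_atTop 1] with n hn
  have hn1 : (1 : ℝ) ≤ n := by exact_mod_cast hn
  have h0 : (0 : ℝ) ≤ 1 / n := by positivity
  have h1 : 1 / (n : ℝ) ≤ 1 := by
    rw [div_le_one (by linarith)]
    exact hn1
  rw [Real.norm_of_nonneg (by positivity), Real.norm_of_nonneg h0]
  nlinarith

lemma tendsto_two_mul_atTop : Tendsto (fun n : ℕ => 2 * n) atTop atTop :=
  tendsto_id.const_mul_atTop' two_pos

lemma isBigO_one_div_two_mul :
    (fun n : ℕ => 1 / ((2 * n : ℕ) : ℝ)) =O[atTop] fun n : ℕ => 1 / (n : ℝ) := by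
  refine (isBigO_const_mul_one_div (1 / 2)).congr_left fun n => ?_
  push_cast
  rw [one_div_mul_one_div]

lemma log_factorial_two_mul_add_isBigO (s : ℕ) :
    (fun n : ℕ => log (2 * n + s).factorial
      - ((2 * n + s + 1 / 2) * (log 2 + log n) - 2 * n + log (2 * π) / 2
        + ((s : ℝ) ^ 2 / 2 + s / 2 + 1 / 12) * (1 / n) / 2))
      =O[atTop] fun n : ℕ => (1 / (n : ℝ)) ^ 2 := by
  refine (((log_factorial_add_isBigO s).comp_tendsto tendsto_two_mul_atTop).trans
    (isBigO_one_div_two_mul.pow 2)).congr' ?_ EventuallyEq.rfl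
  filter_upwards [eventually_ne_atTop 0] with n hn
  have : (n : ℝ) ≠ 0 := by exact_mod_cast hn
  simp only [Function.comp_apply]
  push_cast
  rw [log_mul two_ne_zero this]
  field_simp

lemma logOddSuperfactorial_add_isBigO (s : ℕ) :
    (fun n : ℕ => logOddSuperfactorial (n + s)
      - ((n ^ 2 + 2 * s * n + s ^ 2 - 1 / 24 + n + s + 1 / 4) * (log 2 + log n)
        - 3 / 2 * (n : ℝ) ^ 2 - 2 * s * n - n / 2 + (n + s) * (log (2 * π) / 2)
        + zetaDerivNegOne / 2 - (n + s) / 2 * log 2 - (n + s + 1 / 2) / 2 * log n))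
      =O[atTop] fun n : ℕ => 1 / (n : ℝ) := by
  have h1 := ((logSuperfactorial_add_isBigO (2 * s)).comp_tendsto tendsto_two_mul_atTop).trans
    isBigO_one_div_two_mul
  have h2 := (log_factorial_two_mul_add_isBigO (2 * s)).trans isBigO_one_div_sq
  have h3 := (log_factorial_add_isBigO s).trans isBigO_one_div_sq
  have h4 := isBigO_const_mul_one_div (((((2 * s : ℕ) : ℝ) ^ 2 / 2 + ((2 * s : ℕ) : ℝ) / 2 + 1 / 12)
    / 2 - ((s : ℝ) ^ 2 / 2 + s / 2 + 1 / 12)) / 2)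
  refine ((((h1.add h2).sub h3).const_mul_left (1 / 2)).add h4).congr' ?_ EventuallyEq.rfl
  filter_upwards [eventually_ne_atTop 0] with n hn
  have : (n : ℝ) ≠ 0 := by exact_mod_cast hn
  rw [logOddSuperfactorial_eq, show 2 * (n + s) = 2 * n + 2 * s by ring]
  simp only [Function.comp_apply]
  push_cast
  rw [log_mul two_ne_zero this]
  ring

end InducedSpherical

end

theorem mainTheorem4 (α c : ℕ) :
    ((fun n : ℕ => Real.log (InducedSpherical.ZC α c n) -
        ((-1 / 2 : ℝ) * (n : ℝ) ^ 2
          + (1 / 2 : ℝ) * ((n : ℝ) * Real.log n)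
          + (Real.log (2 * Real.pi) / 2 - 1 - α - c) * (n : ℝ)
          + (0 : ℝ) * Real.sqrt n
          + (((α : ℝ) ^ 2 + (c : ℝ) ^ 2) / 2 + 1 / 3) * Real.log n
          + (Real.log (2 * Real.pi) / 2 - 1 / 12 + 2 * InducedSpherical.zetaDerivNegOne
              - 1 / 2 * ((α : ℝ) + c) * ((α : ℝ) + c + 1 - Real.log (2 * Real.pi))
              - Real.log (InducedSpherical.barnesG ((α : ℝ) + 1)
                  * InducedSpherical.barnesG ((c : ℝ) + 1)))))
      =O[Filter.atTop] fun n : ℕ => 1 / (n : ℝ))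
    ∧
    ((fun n : ℕ => Real.log (InducedSpherical.ZH α c n) -
        ((-1 : ℝ) * (n : ℝ) ^ 2
          + (1 / 2 : ℝ) * ((n : ℝ) * Real.log n)
          + (Real.log (4 * Real.pi) / 2 - 2 - 2 * α - 2 * c) * (n : ℝ)
          + (0 : ℝ) * Real.sqrt n
          + ((α : ℝ) ^ 2 + (α : ℝ) / 2 + (c : ℝ) ^ 2 + (c : ℝ) / 2 + 5 / 12) * Real.log n
          + (Real.log (2 * Real.pi) - 13 / 24 + 4 * InducedSpherical.zetaDerivNegOne
              - ((α : ℝ) + c) * ((α : ℝ) + c + 3 / 2 - Real.log (2 * Real.pi))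
              - Real.log (InducedSpherical.barnesG ((α : ℝ) + 1)
                  * InducedSpherical.barnesG ((α : ℝ) + 3 / 2)
                  * InducedSpherical.barnesG ((c : ℝ) + 1)
                  * InducedSpherical.barnesG ((c : ℝ) + 3 / 2)))))
      =O[Filter.atTop] fun n : ℕ => 1 / (n : ℝ)) := by
  have hG : ∀ (m : ℕ) (x : ℝ), 1 ≤ x → InducedSpherical.barnesG (m + x) ≠ 0 := fun m x hx =>
    (InducedSpherical.barnesG_pos (by linarith [(Nat.cast_nonneg m : (0 : ℝ) ≤ m)])).ne'
  have h2π : Real.log (2 * Real.pi) = Real.log 2 + Real.log Real.pi :=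
    Real.log_mul two_ne_zero Real.pi_ne_zero
  have h4π : Real.log (4 * Real.pi) = 2 * Real.log 2 + Real.log Real.pi := by
    rw [Real.log_mul four_ne_zero Real.pi_ne_zero, show (4 : ℝ) = 2 ^ 2 by norm_num, Real.log_pow]
    push_cast
    ring
  have hfac := (InducedSpherical.log_factorial_add_isBigO 0).trans
    InducedSpherical.isBigO_one_div_sq
  -- The constant `1 / 12` below restores the first correction in Stirling's formula for `n!`, which
  -- is itself `O(1 / n)` and absent from the claimed expansions.
  constructor
  · have hrem := InducedSpherical.isBigO_natCast_mul
      (InducedSpherical.log_factorial_add_isBigO (α + c))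
    refine ((((hfac.add (InducedSpherical.logSuperfactorial_add_isBigO c)).add
      (InducedSpherical.logSuperfactorial_add_isBigO α)).sub hrem).add
      (InducedSpherical.isBigO_const_mul_one_div (1 / 12))).congr' ?_ EventuallyEq.rfl
    filter_upwards [eventually_ne_atTop 0] with n hn
    have hn' : (n : ℝ) ≠ 0 := by exact_mod_cast hn
    rw [InducedSpherical.log_ZC hn, Real.log_mul (hG α 1 le_rfl) (hG c 1 le_rfl),
      ← InducedSpherical.logSuperfactorial_eq_log_barnesG c,
      ← InducedSpherical.logSuperfactorial_eq_log_barnesG α]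
    simp only [add_zero]
    push_cast
    field_simp
    ring
  · have hrem := InducedSpherical.isBigO_natCast_mul
      (InducedSpherical.log_factorial_two_mul_add_isBigO (2 * (α + c) + 1))
    refine ((((hfac.add (InducedSpherical.logOddSuperfactorial_add_isBigO c)).add
      (InducedSpherical.logOddSuperfactorial_add_isBigO α)).sub hrem).add
      (InducedSpherical.isBigO_const_mul_one_div (1 / 12))).congr' ?_ EventuallyEq.rfl
    filter_upwards [eventually_ne_atTop 0] with n hn
    have hn' : (n : ℝ) ≠ 0 := by exact_mod_cast hn
    have h32 : (1 : ℝ) ≤ 3 / 2 := by norm_num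
    rw [InducedSpherical.log_ZH hn,
      Real.log_mul (mul_ne_zero (mul_ne_zero (hG α 1 le_rfl) (hG α _ h32)) (hG c 1 le_rfl))
        (hG c _ h32),
      Real.log_mul (mul_ne_zero (hG α 1 le_rfl) (hG α _ h32)) (hG c 1 le_rfl),
      Real.log_mul (hG α 1 le_rfl) (hG α _ h32),
      InducedSpherical.logOddSuperfactorial_eq_log_barnesG c,
      InducedSpherical.logOddSuperfactorial_eq_log_barnesG α,
      InducedSpherical.log_barnesG_three_halves, h4π, h2π]
    simp only [add_zero]
    push_cast
    field_simp
    ring
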